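/- Conventions. Let $\mathbb K$ be $\mathbb R$ or $\mathbb C$. A Banach algebra dynamical system $(A,G,\alpha)$ consists of a (not necessarily unital) Banach algebra $A$ over $\mathbb K$, a locally compact Hausdorff group $G$ with left Haar measure $ds$ and modular function $\Delta$ (normalised by $\Delta(r)\int_G f(sr)\,ds=\int_G f(s)\,ds$ for $f\in C_c(G)$), and a strongly continuous action $\alpha$ of $G$ on $A$ by bounded algebra automorphisms. A continuous covariant representation $(\pi,U)$ on a Banach space $X$ consists of a bounded algebra homomorphism $\pi:A\to B(X)$ and a strongly continuous group homomorphism $U:G\to \mathrm{Inv}(X)$ into the invertible elements of $B(X)$ such that $\pi(\alpha_s(a))=U_s\pi(a)U_s^{-1}$; it is non-degenerate if the span of $\{\pi(a)x: a\in A,\,x\in X\}$ is dense in $X$. (Non-degeneracy of a representation of any other algebra is defined in the same way.) For $f\in C_c(G,A)$ put $\pi\rtimes U(f)x=\int_G\pi(f(s))U_sx\,ds$; this is multiplicative for the twisted convolution $[f*g](s)=\int_G f(r)\alpha_r(g(r^{-1}s))\,dr$. For a non-empty class $\mathcal R$ of continuous covariant representations on Banach spaces such that $\|\pi\|$, and $\|U_r\|$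 for $r$ in any given compact set, are bounded uniformly over $(\pi,U)\in\mathcal R$, let $\sigma^{\mathcal R}(f)=\sup_{(\pi,U)\in\mathcal R}\|\pi\rtimes U(f)\|$, and let $(A\rtimes_\alpha G)^{\mathcal R}$ be the Banach algebra obtained by completing $C_c(G,A)/\ker\sigma^{\mathcal R}$, with canonical map $q^{\mathcal R}:C_c(G,A)\to(A\rtimes_\alpha G)^{\mathcal R}$. For $(\pi,U)\in\mathcal R$, let $(\pi\rtimes U)^{\mathcal R}$ be the contractive representation of $(A\rtimes_\alpha G)^{\mathcal R}$ determined by $(\pi\rtimes U)^{\mathcal R}(q^{\mathcal R}(f))=\pi\rtimes U(f)$. The system is involutive if $\mathbb K=\mathbb C$, $A$ has a bounded involution and all $\alpha_s$ preserve it. A continuous covariant representation $(\pi,U)$ is involutive if its space is a Hilbert space, $\pi$ is a $*$-representation and $U$ is unitary; $\mathcal R$ is involutive if all its members are. If the system and $\mathcal R$ are involutive, the crossed product carries the involution with $q^{\mathcal R}(f)^*=q^{\mathcal R}(f^*)$, where $f^*(s)=\Delta(s^{-1})\alpha_s(f(s^{-1})^*)$. Theorem. Let $(A,G,\alpha)$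 be a Banach algebra dynamical system such that, for each $\varepsilon>0$, $A$ has a $(1+\varepsilon)$-bounded approximate left identity. Let $\mathcal Z$ be a neighbourhood basis of $e\in G$ all of whose elements are contained in a fixed compact set, and let $\nu:G\to[0,\infty)$ be bounded on compact sets with $\inf_{V\in\mathcal Z}\sup_{r\in V}\nu(r)=1$. Let $\mathcal R$ be a non-empty class of non-degenerate continuous covariant representations of $(A,G,\alpha)$ on Banach spaces such that, for all $(\pi,U)\in\mathcal R$, $\pi$ is contractive and $\|U_r\|\le\nu(r)$ for all $r\in G$. Let $\mathcal X$ be a class of Banach spaces, and suppose that $\mathcal R$ contains the class $\mathcal R'$ of all non-degenerate continuous covariant representations $(\pi,U)$ of $(A,G,\alpha)$ in spaces from $\mathcal X$ with $\pi$ contractive and $\|U_r\|\le\nu(r)$ for all $r\in G$. Suppose that $\mathcal R'$ is non-empty. Then: 1. The map $(\pi,U)\mapsto(\pi\rtimes U)^{\mathcal R}$, which preserves the representation space, is a bijection between $\mathcal R'$ and the non-degenerate contractive representations of $(A\rtimes_\alpha G)^{\mathcal R}$ in spaces from $\mathcal X$. 2. For $(\pi,U)\in\mathcal R'$, a closed subspace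 is invariant under both $\pi(A)$ and $U(G)$ if and only if it is invariant under $(\pi\rtimes U)^{\mathcal R}$. 3. For $(\pi,U),(\rho,V)\in\mathcal R'$ on spaces $X,Y$, a bounded operator $\Phi:X\to Y$ intertwines $\pi$ with $\rho$ and $U$ with $V$ if and only if it intertwines $(\pi\rtimes U)^{\mathcal R}$ and $(\rho\rtimes V)^{\mathcal R}$. 4. If $(A,G,\alpha)$ and $\mathcal R$ are involutive, then $(\pi,U)\in\mathcal R'$ is involutive if and only if $(\pi\rtimes U)^{\mathcal R}$ is an involutive representation of $(A\rtimes_\alpha G)^{\mathcal R}$. -/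

import Mathlib

open MeasureTheory Filter Topology Set
open scoped CompactlySupported NNReal

universe w

set_option linter.style.haveILetI false
set_option linter.unusedSectionVars false

namespace BanachCP

noncomputable section

/-! ### Banach spaces, representations, bounded left approximate identities -/

/-- A Banach space over `𝕜`, bundled.  A class of Banach spaces is a `Set (BanachSp 𝕜)`. -/
structure BanachSp (𝕜 : Type*) [RCLike 𝕜] where
  /-- the underlying space -/
  carrier : Type w
  [normed : NormedAddCommGroup carrier]
  [space : NormedSpace 𝕜 carrier]
  [complete : CompleteSpace carrier]

instance (𝕜 : Type*) [RCLike 𝕜] : CoeSort (BanachSp.{w} 𝕜) (Type w) := ⟨BanachSp.carrier⟩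

attribute [instance] BanachSp.normed BanachSp.space BanachSp.complete

/-- `A` has an `M`-bounded left approximate identity (nets in `A` are encoded as filters). -/
def HasBddLeftApproxId (A : Type*) [NonUnitalNormedRing A] (M : ℝ) : Prop :=
  ∃ l : Filter A, l.NeBot ∧ (∀ᶠ u in l, ‖u‖ ≤ M) ∧ ∀ a : A, Tendsto (fun u => u * a) l (𝓝 a)

section Representations

variable {𝕜 : Type*} [RCLike 𝕜] {B : Type*} [NonUnitalNormedRing B] [NormedSpace 𝕜 B]
  {X : Type*} [NormedAddCommGroup X] [NormedSpace 𝕜 X]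
  {Y : Type*} [NormedAddCommGroup Y] [NormedSpace 𝕜 Y]

/-- The span of `{π(b)x}` is dense. -/
def RepNonDegenerate (π : B →ₙₐ[𝕜] (X →L[𝕜] X)) : Prop :=
  Dense (Submodule.span 𝕜 {y : X | ∃ (b : B) (x : X), y = π b x} : Set X)

/-- `‖π‖ ≤ 1`. -/
def RepContractive (π : B →ₙₐ[𝕜] (X →L[𝕜] X)) : Prop := ∀ b : B, ‖π b‖ ≤ ‖b‖

/-- The subspace `Z` is invariant under all `π(b)`. -/
def RepInvariant (π : B →ₙₐ[𝕜] (X →L[𝕜] X)) (Z : Submodule 𝕜 X) : Prop :=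
  ∀ b : B, ∀ x ∈ Z, π b x ∈ Z

/-- `Φ` intertwines `π` and `ρ`. -/
def RepIntertwines (π : B →ₙₐ[𝕜] (X →L[𝕜] X)) (ρ : B →ₙₐ[𝕜] (Y →L[𝕜] Y)) (Φ : X →L[𝕜] Y) : Prop :=
  ∀ b : B, ρ b ∘L Φ = Φ ∘L π b

/-- `π` is involutive with respect to the operation `st` on `B`: the norm of the representation
space `X` comes from an inner product for which `π(st b)` is the adjoint of `π(b)`. -/
def RepInvolutive (st : B → B) (π : B →ₙₐ[𝕜] (X →L[𝕜] X)) : Prop :=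
  ∃ H : InnerProductSpace 𝕜 X, H.toNormedSpace = ‹NormedSpace 𝕜 X› ∧
    ∀ (b : B) (x y : X), H.inner (π b x) y = H.inner x (π (st b) y)

end Representations

/-! ### The Bochner integral in a Banach space over `𝕜` -/

section Integral

variable (𝕜 : Type*) [RCLike 𝕜] {G : Type*} [MeasurableSpace G] (μ : Measure G)
  {X : Type*} [NormedAddCommGroup X] [NormedSpace 𝕜 X]

/-- The Bochner integral in a `𝕜`-normed space, seen as a real normed space. -/
def gint (f : G → X) : X :=
  letI : NormedSpace ℝ X := NormedSpace.restrictScalars ℝ 𝕜 X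
  ∫ s, f s ∂μ

variable {𝕜 μ}

theorem gint_add {f g : G → X} (hf : Integrable f μ) (hg : Integrable g μ) :
    gint 𝕜 μ (fun s => f s + g s) = gint 𝕜 μ f + gint 𝕜 μ g := by
  letI : NormedSpace ℝ X := NormedSpace.restrictScalars ℝ 𝕜 X
  exact integral_add hf hg

theorem gint_smul (c : 𝕜) (f : G → X) :
    gint 𝕜 μ (fun s => c • f s) = c • gint 𝕜 μ f := by
  letI : NormedSpace ℝ X := NormedSpace.restrictScalars ℝ 𝕜 X
  haveI : IsScalarTower ℝ 𝕜 X := RestrictScalars.isScalarTower ℝ 𝕜 X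
  haveI : SMulCommClass ℝ 𝕜 X := inferInstance
  exact integral_smul c f

theorem gint_comm {Y : Type*} [NormedAddCommGroup Y] [NormedSpace 𝕜 Y] [CompleteSpace X]
    [CompleteSpace Y] (L : X →L[𝕜] Y) {f : G → X} (hf : Integrable f μ) :
    gint 𝕜 μ (fun s => L (f s)) = L (gint 𝕜 μ f) := by
  letI : NormedSpace ℝ X := NormedSpace.restrictScalars ℝ 𝕜 X
  letI : NormedSpace ℝ Y := NormedSpace.restrictScalars ℝ 𝕜 Y
  exact L.integral_comp_comm hf

theorem norm_gint_le {f : G → X} : ‖gint 𝕜 μ f‖ ≤ ∫ s, ‖f s‖ ∂μ := by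
  letI : NormedSpace ℝ X := NormedSpace.restrictScalars ℝ 𝕜 X
  exact norm_integral_le_integral_norm f

theorem gint_eq_integral (f : G → 𝕜) : gint 𝕜 μ f = ∫ s, f s ∂μ := by
  have : NormedSpace.restrictScalars ℝ 𝕜 𝕜 = (inferInstance : NormedSpace ℝ 𝕜) := by
    ext r z
    exact (RCLike.real_smul_eq_coe_mul r z).symm
  unfold gint
  rw [this]

variable [TopologicalSpace G] [BorelSpace G]

theorem gint_swap [IsFiniteMeasureOnCompacts μ] {f : G → G → X} (hf : Continuous f.uncurry)
    (hc : HasCompactSupport f.uncurry) :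
    gint 𝕜 μ (fun s => gint 𝕜 μ (fun r => f s r)) =
      gint 𝕜 μ (fun r => gint 𝕜 μ (fun s => f s r)) := by
  letI : NormedSpace ℝ X := NormedSpace.restrictScalars ℝ 𝕜 X
  exact integral_integral_swap_of_hasCompactSupport hf hc

variable [Group G] [IsTopologicalGroup G]

theorem gint_mul_left [μ.IsMulLeftInvariant] (g : G) (f : G → X) :
    gint 𝕜 μ (fun s => f (g * s)) = gint 𝕜 μ f := by
  letI : NormedSpace ℝ X := NormedSpace.restrictScalars ℝ 𝕜 X
  exact integral_mul_left_eq_self f g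

theorem continuous_gint [LocallyCompactSpace G] [IsFiniteMeasureOnCompacts μ] {f : G → G → X}
    (hf : Continuous f.uncurry) {k : Set G} (hk : IsCompact k) (h : ∀ p x, x ∉ k → f p x = 0) :
    Continuous (fun p => gint 𝕜 μ (f p)) := by
  letI : NormedSpace ℝ X := NormedSpace.restrictScalars ℝ 𝕜 X
  rw [← continuousOn_univ]
  exact continuousOn_integral_of_compact_support hk hf.continuousOn (fun p x _ hx => h p x hx)

end Integral

/-! ### Strongly continuous group representations are jointly continuous -/

section Joint

variable {𝕜 : Type*} [RCLike 𝕜] {G : Type*} [Group G] [TopologicalSpace G]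
  {X : Type*} [NormedAddCommGroup X] [NormedSpace 𝕜 X] [CompleteSpace X]

theorem bdd_on_compact {U : G → (X →L[𝕜] X)} (hU : ∀ x, Continuous fun s => U s x)
    {K : Set G} (hK : IsCompact K) : ∃ C, ∀ s ∈ K, ‖U s‖ ≤ C := by
  obtain ⟨C, hC⟩ := banach_steinhaus (g := fun s : K => U s) (fun x => by
    obtain ⟨C, hC⟩ := hK.exists_bound_of_continuousOn (hU x).continuousOn
    exact ⟨C, fun i => hC i i.2⟩)
  exact ⟨C, fun s hs => hC ⟨s, hs⟩⟩

theorem joint_continuous [LocallyCompactSpace G] {U : G → (X →L[𝕜] X)}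
    (hU : ∀ x, Continuous fun s => U s x) : Continuous fun p : G × X => U p.1 p.2 := by
  rw [continuous_iff_continuousAt]
  rintro ⟨r, x⟩
  obtain ⟨K, hK, hKr⟩ := exists_compact_mem_nhds r
  obtain ⟨C, hC⟩ := bdd_on_compact hU hK
  have h1 : Tendsto (fun p : G × X => U p.1 (p.2 - x)) (𝓝 (r, x)) (𝓝 0) := by
    apply squeeze_zero_norm' (a := fun p : G × X => C * ‖p.2 - x‖)
    · have : ∀ᶠ p : G × X in 𝓝 (r, x), p.1 ∈ K := continuous_fst.continuousAt.eventually hKr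
      filter_upwards [this] with p hp
      exact ((U p.1).le_opNorm _).trans (by gcongr; exact hC _ hp)
    · have : Continuous fun p : G × X => C * ‖p.2 - x‖ := by fun_prop
      simpa using this.tendsto (r, x)
  have h2 : Tendsto (fun p : G × X => U p.1 x) (𝓝 (r, x)) (𝓝 (U r x)) :=
    ((hU x).comp continuous_fst).tendsto (r, x)
  have := h1.add h2
  simpa [ContinuousAt] using this

end Joint

/-! ### Banach algebra dynamical systems and covariant representations -/

/-- A dynamical system `(A, G, α)`: `α` is a strongly continuous action of `G` on `A` by bounded
algebra automorphisms (a homomorphism from a group into the monoid `A →L[𝕜] A` automatically has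
invertible values). -/
structure DynSys (𝕜 G A : Type*) [RCLike 𝕜] [Group G] [TopologicalSpace G]
    [NonUnitalNormedRing A] [NormedSpace 𝕜 A] where
  /-- the action -/
  act : G →* (A →L[𝕜] A)
  act_mul : ∀ (s : G) (a b : A), act s (a * b) = act s a * act s b
  act_cont : ∀ a : A, Continuous fun s => act s a

section Covariant

variable {𝕜 G A : Type*} [RCLike 𝕜] [Group G] [TopologicalSpace G]
  [NonUnitalNormedRing A] [NormedSpace 𝕜 A]

/-- A continuous covariant representation `(π, U)` of `(A, G, α)` on `X`. -/
structure ContCovRep (α : DynSys 𝕜 G A) (X : Type*) [NormedAddCommGroup X] [NormedSpace 𝕜 X] where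
  /-- the representation of the algebra -/
  π : A →ₙₐ[𝕜] (X →L[𝕜] X)
  /-- the representation of the group (its values are automatically invertible) -/
  U : G →* (X →L[𝕜] X)
  covariant : ∀ (a : A) (s : G), π (α.act s a) = U s * π a * U s⁻¹
  bounded : ∃ C : ℝ, ∀ a : A, ‖π a‖ ≤ C * ‖a‖
  strongCont : ∀ x : X, Continuous fun s => U s x

namespace ContCovRep

variable {α : DynSys 𝕜 G A} {X : Type*} [NormedAddCommGroup X] [NormedSpace 𝕜 X]
  {Y : Type*} [NormedAddCommGroup Y] [NormedSpace 𝕜 Y]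

/-- Invariance of a subspace under both `π(A)` and `U(G)`. -/
def Invariant (ρ : ContCovRep α X) (Z : Submodule 𝕜 X) : Prop :=
  RepInvariant ρ.π Z ∧ ∀ (r : G), ∀ x ∈ Z, ρ.U r x ∈ Z

/-- `Φ` intertwines both the algebra representations and the group representations. -/
def Intertwines (ρ : ContCovRep α X) (τ : ContCovRep α Y) (Φ : X →L[𝕜] Y) : Prop :=
  RepIntertwines ρ.π τ.π Φ ∧ ∀ r : G, τ.U r ∘L Φ = Φ ∘L ρ.U r

/-- `(π, U)` is involutive: the norm of `X` comes from an inner product for which `π` is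
involutive and each (invertible) `U r` is unitary. -/
def Involutive [Star A] (ρ : ContCovRep α X) : Prop :=
  ∃ H : InnerProductSpace 𝕜 X, H.toNormedSpace = ‹NormedSpace 𝕜 X› ∧
    (∀ (a : A) (x y : X), H.inner (ρ.π a x) y = H.inner x (ρ.π (star a) y)) ∧
    ∀ (r : G) (x y : X), H.inner (ρ.U r x) (ρ.U r y) = H.inner x y

/-- `a ↦ π(a)` as a bounded operator. -/
def πL (ρ : ContCovRep α X) : A →L[𝕜] (X →L[𝕜] X) :=
  LinearMap.mkContinuousOfExistsBound
    { toFun := fun a => ρ.π a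
      map_add' := fun a b => map_add ρ.π a b
      map_smul' := fun c a => map_smul ρ.π c a } ρ.bounded

@[simp] theorem πL_apply (ρ : ContCovRep α X) (a : A) : ρ.πL a = ρ.π a := rfl

theorem U_inv_apply (ρ : ContCovRep α X) (r : G) (x : X) : ρ.U r⁻¹ (ρ.U r x) = x := by
  have : ρ.U r⁻¹ * ρ.U r = 1 := by rw [← map_mul]; simp
  exact congrArg (fun T : X →L[𝕜] X => T x) this

theorem U_mul_apply (ρ : ContCovRep α X) (r s : G) (x : X) :
    ρ.U (r * s) x = ρ.U r (ρ.U s x) := by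
  rw [map_mul]; rfl

theorem cov_apply (ρ : ContCovRep α X) (a : A) (s : G) (x : X) :
    ρ.π (α.act s a) (ρ.U s x) = ρ.U s (ρ.π a x) := by
  rw [ρ.covariant]
  simp [U_inv_apply]

variable [MeasurableSpace G] (μ : Measure G)

/-- The integrand `s ↦ π(f(s)) U_s x` of the integrated form. -/
def integrand (ρ : ContCovRep α X) (f : C_c(G, A)) (x : X) (s : G) : X := ρ.π (f s) (ρ.U s x)

theorem continuous_integrand (ρ : ContCovRep α X) (f : C_c(G, A)) (x : X) :
    Continuous (ρ.integrand f x) :=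
  (ρ.πL.continuous.comp f.continuous).clm_apply (ρ.strongCont x)

theorem compact_integrand (ρ : ContCovRep α X) (f : C_c(G, A)) (x : X) :
    HasCompactSupport (ρ.integrand f x) :=
  f.hasCompactSupport.mono fun s hs => by
    contrapose! hs
    simp only [Function.mem_support, not_not] at hs
    simp [integrand, hs]

variable [BorelSpace G] [IsFiniteMeasureOnCompacts μ]

theorem integrable_integrand (ρ : ContCovRep α X) (f : C_c(G, A)) (x : X) :
    Integrable (ρ.integrand f x) μ :=
  (ρ.continuous_integrand f x).integrable_of_hasCompactSupport (ρ.compact_integrand f x)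

theorem norm_gint_integrand_le (ρ : ContCovRep α X) (f : C_c(G, A)) (x : X) {C M : ℝ}
    (hC : ∀ a, ‖ρ.π a‖ ≤ C * ‖a‖) (hC0 : 0 ≤ C) (hM : ∀ s ∈ tsupport f, ‖ρ.U s‖ ≤ M) :
    ‖gint 𝕜 μ (ρ.integrand f x)‖ ≤ C * M * (∫ s, ‖f s‖ ∂μ) * ‖x‖ := by
  have hi : Integrable (fun s => ‖f s‖) μ :=
    (f.continuous.integrable_of_hasCompactSupport f.hasCompactSupport).norm
  calc ‖gint 𝕜 μ (ρ.integrand f x)‖ ≤ ∫ s, ‖ρ.integrand f x s‖ ∂μ := norm_gint_le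
    _ ≤ ∫ s, (C * M * ‖x‖) * ‖f s‖ ∂μ := by
        apply integral_mono (ρ.integrable_integrand μ f x).norm (hi.const_mul _)
        intro s
        by_cases hs : s ∈ tsupport f
        · calc ‖ρ.π (f s) (ρ.U s x)‖ ≤ ‖ρ.π (f s)‖ * (‖ρ.U s‖ * ‖x‖) :=
                ((ρ.π (f s)).le_opNorm _).trans (by gcongr; exact (ρ.U s).le_opNorm _)
            _ ≤ (C * ‖f s‖) * (M * ‖x‖) := by
                gcongr
                · exact hC _
                · exact hM s hs
            _ = (C * M * ‖x‖) * ‖f s‖ := by ring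
        · have : f s = 0 := image_eq_zero_of_notMem_tsupport hs
          simp [integrand, this]
    _ = C * M * (∫ s, ‖f s‖ ∂μ) * ‖x‖ := by rw [integral_const_mul]; ring

variable [CompleteSpace X]

/-- The integrated form `(π ⋊ U)(f) = ∫ π(f(s)) U_s ds`, the integral being taken pointwise on
`X`. -/
def integrated (ρ : ContCovRep α X) (f : C_c(G, A)) : X →L[𝕜] X :=
  LinearMap.mkContinuousOfExistsBound
    { toFun := fun x => gint 𝕜 μ (fun s => ρ.π (f s) (ρ.U s x))
      map_add' := fun x y => by
        refine Eq.trans ?_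
          (gint_add (ρ.integrable_integrand μ f x) (ρ.integrable_integrand μ f y))
        simp
      map_smul' := fun c x => by
        simp only [RingHom.id_apply, ← gint_smul, map_smul] }
    (by
      obtain ⟨C, hC⟩ := ρ.bounded
      obtain ⟨M, hM⟩ := bdd_on_compact ρ.strongCont f.hasCompactSupport
      refine ⟨|C| * M * (∫ s, ‖f s‖ ∂μ), fun x => ?_⟩
      exact ρ.norm_gint_integrand_le μ f x
        (fun a => (hC a).trans (by gcongr; exact le_abs_self C)) (abs_nonneg C) hM)

theorem integrated_apply (ρ : ContCovRep α X) (f : C_c(G, A)) (x : X) :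
    ρ.integrated μ f x = gint 𝕜 μ (fun s => ρ.π (f s) (ρ.U s x)) := rfl

theorem integrated_add (ρ : ContCovRep α X) (f g : C_c(G, A)) :
    ρ.integrated μ (f + g) = ρ.integrated μ f + ρ.integrated μ g := by
  ext x
  simp only [integrated_apply, add_apply]
  refine Eq.trans ?_ (gint_add (ρ.integrable_integrand μ f x) (ρ.integrable_integrand μ g x))
  simp

theorem integrated_smul (ρ : ContCovRep α X) (c : 𝕜) (f : C_c(G, A)) :
    ρ.integrated μ (c • f) = c • ρ.integrated μ f := by
  ext x
  simp only [integrated_apply, smul_apply, ← gint_smul]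
  simp

end ContCovRep

end Covariant

/-! ### Twisted convolution -/

section Convolution

variable {𝕜 G A : Type*} [RCLike 𝕜] [Group G] [TopologicalSpace G] [IsTopologicalGroup G]
  [T2Space G] [LocallyCompactSpace G] [MeasurableSpace G] [BorelSpace G]
  [NonUnitalNormedRing A] [NormedSpace 𝕜 A] [CompleteSpace A]
  [IsScalarTower 𝕜 A A] [SMulCommClass 𝕜 A A]
  (μ : Measure G) [μ.IsHaarMeasure] (α : DynSys 𝕜 G A)

theorem continuous_convIntegrand (f g : C_c(G, A)) :
    Continuous (fun p : G × G => f p.2 * α.act p.2 (g (p.2⁻¹ * p.1))) := by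
  have h := joint_continuous α.act_cont
  have h2 : Continuous (fun p : G × G => (p.2, g (p.2⁻¹ * p.1))) := by
    have := g.continuous
    fun_prop
  exact (f.continuous.comp continuous_snd).mul (h.comp h2)

theorem conv_support (f g : C_c(G, A)) (s r : G) (h : f r * α.act r (g (r⁻¹ * s)) ≠ 0) :
    r ∈ tsupport f ∧ r⁻¹ * s ∈ tsupport g := by
  constructor
  · refine subset_tsupport _ fun h0 => h ?_
    rw [h0, zero_mul]
  · refine subset_tsupport _ fun h0 => h ?_
    rw [h0, map_zero, mul_zero]

/-- The twisted convolution `(f * g)(s) = ∫ f(r) α_r(g(r⁻¹ s)) dr` on `C_c(G, A)`. -/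
def conv (f g : C_c(G, A)) : C_c(G, A) where
  toFun s := gint 𝕜 μ (fun r => f r * α.act r (g (r⁻¹ * s)))
  continuous_toFun := by
    apply continuous_gint (continuous_convIntegrand α f g) f.hasCompactSupport
    intro s r hr
    by_contra h
    exact hr (conv_support α f g s r h).1
  hasCompactSupport' := by
    apply HasCompactSupport.of_support_subset_isCompact
      (f.hasCompactSupport.isCompact.mul g.hasCompactSupport.isCompact)
    intro s hs
    by_contra hns
    apply hs
    have : (fun r => f r * α.act r (g (r⁻¹ * s))) = fun _ => (0 : A) := by
      funext r
      by_contra h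
      obtain ⟨h1, h2⟩ := conv_support α f g s r h
      exact hns ⟨r, h1, r⁻¹ * s, h2, by simp⟩
    change gint 𝕜 μ (fun r => f r * α.act r (g (r⁻¹ * s))) = 0
    rw [this]
    simp [gint]

theorem conv_apply (f g : C_c(G, A)) (s : G) :
    conv μ α f g s = gint 𝕜 μ (fun r => f r * α.act r (g (r⁻¹ * s))) := rfl

theorem integrable_convIntegrand (f g : C_c(G, A)) (s : G) :
    Integrable (fun r => f r * α.act r (g (r⁻¹ * s))) μ := by
  apply Continuous.integrable_of_hasCompactSupport
  · exact (continuous_convIntegrand α f g).comp (Continuous.prodMk_right s)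
  · apply f.hasCompactSupport.mono'
    intro r hr
    exact (conv_support α f g s r hr).1

theorem conv_add (f g h : C_c(G, A)) : conv μ α f (g + h) = conv μ α f g + conv μ α f h := by
  ext s
  rw [CompactlySupportedContinuousMap.add_apply, conv_apply, conv_apply, conv_apply,
    ← gint_add (integrable_convIntegrand μ α f g s) (integrable_convIntegrand μ α f h s)]
  simp [mul_add]

theorem add_conv (f g h : C_c(G, A)) : conv μ α (f + g) h = conv μ α f h + conv μ α g h := by
  ext s
  rw [CompactlySupportedContinuousMap.add_apply, conv_apply, conv_apply, conv_apply,
    ← gint_add (integrable_convIntegrand μ α f h s) (integrable_convIntegrand μ α g h s)]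
  simp [add_mul]

theorem smul_conv (c : 𝕜) (f g : C_c(G, A)) : conv μ α (c • f) g = c • conv μ α f g := by
  ext s
  rw [CompactlySupportedContinuousMap.smul_apply, conv_apply, conv_apply, ← gint_smul]
  simp [smul_mul_assoc]

theorem conv_smul (c : 𝕜) (f g : C_c(G, A)) : conv μ α f (c • g) = c • conv μ α f g := by
  ext s
  rw [CompactlySupportedContinuousMap.smul_apply, conv_apply, conv_apply, ← gint_smul]
  simp [mul_smul_comm]

variable {α}

/-- The integrated form is multiplicative for the twisted convolution. -/
theorem ContCovRep.integrated_conv {X : Type*} [NormedAddCommGroup X] [NormedSpace 𝕜 X]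
    [CompleteSpace X] (ρ : ContCovRep α X) (f g : C_c(G, A)) :
    ρ.integrated μ (conv μ α f g) = ρ.integrated μ f * ρ.integrated μ g := by
  ext x
  set F : G → G → X := fun s r => ρ.π (f r) (ρ.U r (ρ.π (g (r⁻¹ * s)) (ρ.U (r⁻¹ * s) x))) with hF
  have key : ∀ s r, ρ.π (f r * α.act r (g (r⁻¹ * s))) (ρ.U s x) = F s r := by
    intro s r
    rw [map_mul, mul_apply_eq_comp]
    have h1 : ρ.U s x = ρ.U r (ρ.U (r⁻¹ * s) x) := by
      rw [← ρ.U_mul_apply]; simp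
    rw [h1, ρ.cov_apply]
  have hJ := joint_continuous ρ.strongCont
  have hcont : Continuous F.uncurry := by
    have h1 : Continuous fun p : G × G => ρ.integrand g x (p.2⁻¹ * p.1) :=
      (ρ.continuous_integrand g x).comp (by fun_prop)
    have h2 : Continuous fun p : G × G => ρ.U p.2 (ρ.integrand g x (p.2⁻¹ * p.1)) :=
      hJ.comp (continuous_snd.prodMk h1)
    exact ((ρ.πL.continuous.comp f.continuous).comp continuous_snd).clm_apply h2
  have hcomp : HasCompactSupport F.uncurry := by
    apply HasCompactSupport.of_support_subset_isCompact
      ((f.hasCompactSupport.isCompact.mul g.hasCompactSupport.isCompact).prod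
        f.hasCompactSupport.isCompact)
    rintro ⟨s, r⟩ hsr
    have h0 : f r * α.act r (g (r⁻¹ * s)) ≠ 0 := by
      intro h0
      apply hsr
      change F s r = 0
      rw [← key, h0]
      simp
    obtain ⟨h1, h2⟩ := conv_support α f g s r h0
    exact ⟨⟨r, h1, r⁻¹ * s, h2, by simp⟩, h1⟩
  calc ρ.integrated μ (conv μ α f g) x
      = gint 𝕜 μ (fun s => gint 𝕜 μ (fun r => F s r)) := by
        rw [ρ.integrated_apply μ]
        congr 1
        funext s
        have := gint_comm (𝕜 := 𝕜) (ρ.πL.flip (ρ.U s x)) (integrable_convIntegrand μ α f g s)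
        simp only [ContinuousLinearMap.flip_apply, ContCovRep.πL_apply, key] at this
        rw [this]
        rfl
    _ = gint 𝕜 μ (fun r => gint 𝕜 μ (fun s => F s r)) := gint_swap hcont hcomp
    _ = gint 𝕜 μ (fun r => ρ.π (f r) (ρ.U r (ρ.integrated μ g x))) := by
        congr 1
        funext r
        rw [ρ.integrated_apply μ,
          ← gint_mul_left (μ := μ) r⁻¹ (fun s => ρ.π (g s) (ρ.U s x))]
        have hi : Integrable (fun s => ρ.integrand g x (r⁻¹ * s)) μ :=
          (ρ.integrable_integrand μ g x).comp_mul_left r⁻¹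
        exact gint_comm (𝕜 := 𝕜) (ρ.π (f r) ∘L ρ.U r) hi
    _ = (ρ.integrated μ f * ρ.integrated μ g) x := by
        rw [mul_apply_eq_comp, ρ.integrated_apply μ f]

end Convolution

/-! ### The modular function and the involution of `C_c(G, A)` -/

section Modular

variable {G : Type*} [Group G] [TopologicalSpace G] [IsTopologicalGroup G] [LocallyCompactSpace G]

/-- The modular function `Δ`, normalised by `Δ(r) ∫ f(s r) ds = ∫ f(s) ds`
for left Haar integrals. -/
def modularFn (r : G) : ℝ := ((Measure.modularCharacter r : ℝ≥0) : ℝ)⁻¹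

theorem modularFn_pos (r : G) : 0 < modularFn r :=
  inv_pos.2 (NNReal.coe_pos.2 (Measure.modularCharacterFun_pos r))

theorem modularFn_integral [MeasurableSpace G] [BorelSpace G] (μ : Measure G) [μ.IsHaarMeasure]
    (r : G) {f : G → ℝ}
    (hf : Continuous f) (hc : HasCompactSupport f) :
    modularFn r * ∫ s, f (s * r) ∂μ = ∫ s, f s ∂μ := by
  have h0 : (Measure.modularCharacter r : ℝ≥0) ≠ 0 := (Measure.modularCharacterFun_pos r).ne'
  have h1 : ∫ s, f (s * r) ∂μ = ∫ s, f s ∂(Measure.map (· * r) μ) :=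
    (integral_map_equiv (MeasurableEquiv.mulRight r) f).symm
  have h2 := Measure.integral_isMulLeftInvariant_eq_smul_of_hasCompactSupport
    (Measure.map (· * r) μ) μ hf hc
  rw [h1, h2, ← Measure.modularCharacterFun_eq_haarScalarFactor μ r,
    integral_smul_nnreal_measure, modularFn, NNReal.smul_def, smul_eq_mul, ← mul_assoc]
  change ((Measure.modularCharacter r : ℝ≥0) : ℝ)⁻¹ * ((Measure.modularCharacter r : ℝ≥0) : ℝ) * _
    = _
  rw [inv_mul_cancel₀ (NNReal.coe_ne_zero.2 h0), one_mul]

theorem continuous_modularFn : Continuous (modularFn : G → ℝ) := by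
  borelize G
  let μ := Measure.haar (G := G)
  obtain ⟨⟨f, hf⟩, hc, h0, h1⟩ : ∃ f : C(G, ℝ), HasCompactSupport f ∧ 0 ≤ f ∧ f 1 ≠ 0 :=
    exists_continuous_nonneg_pos 1
  have hI : 0 < ∫ s, f s ∂μ :=
    hf.integral_pos_of_hasCompactSupport_nonneg_nonzero hc h0 h1
  have hcont : Continuous fun r : G => ∫ s, f (s * r) ∂μ := by
    rw [continuous_iff_continuousAt]
    intro r
    obtain ⟨K, hK, hKr⟩ := exists_compact_mem_nhds r
    refine ContinuousOn.continuousAt (s := K) ?_ hKr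
    refine continuousOn_integral_of_compact_support
      (hc.isCompact.mul hK.inv) (by fun_prop) fun p x hp hx => ?_
    by_contra h
    exact hx ⟨x * p, subset_tsupport _ h, p⁻¹, by simpa using hp, by simp⟩
  have hne : ∀ r : G, ∫ s, f (s * r) ∂μ ≠ 0 := fun r h => by
    have := modularFn_integral μ r hf hc
    rw [h, mul_zero] at this
    exact hI.ne this
  have : (modularFn : G → ℝ) = fun r => (∫ s, f s ∂μ) / ∫ s, f (s * r) ∂μ := by
    funext r
    rw [eq_div_iff (hne r)]
    exact modularFn_integral μ r hf hc
  rw [this]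
  exact continuous_const.div hcont hne

theorem modularFn_mul (r s : G) : modularFn (r * s) = modularFn r * modularFn s := by
  simp [modularFn, map_mul, mul_comm]

theorem modularFn_inv (r : G) : modularFn r⁻¹ = (modularFn r)⁻¹ := by
  have : modularFn r * modularFn r⁻¹ = 1 := by
    rw [← modularFn_mul]
    simp [modularFn]
  exact eq_inv_of_mul_eq_one_right this

/-- `∫ Δ(s⁻¹) f(s⁻¹) ds = ∫ f(s) ds`. -/
theorem integral_modularFn_inv [MeasurableSpace G] [BorelSpace G] (μ : Measure G)
    [μ.IsHaarMeasure] {E : Type*} [NormedAddCommGroup E] [NormedSpace ℝ E]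
    [CompleteSpace E] {f : G → E} (hf : Continuous f) (hc : HasCompactSupport f) :
    ∫ s, modularFn s⁻¹ • f s⁻¹ ∂μ = ∫ s, f s ∂μ := by
  obtain ⟨⟨h, hh⟩, hhc, h0, h1⟩ : ∃ f : C(G, ℝ), HasCompactSupport f ∧ 0 ≤ f ∧ f 1 ≠ 0 :=
    exists_continuous_nonneg_pos 1
  change Continuous h at hh
  change HasCompactSupport h at hhc
  have hI : 0 < ∫ s, h s ∂μ :=
    hh.integral_pos_of_hasCompactSupport_nonneg_nonzero hhc h0 h1
  have e1 : ∀ s, (∫ t, h t ∂μ) • (modularFn s⁻¹ • f s⁻¹) = ∫ t, h (t * s) • f s⁻¹ ∂μ := by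
    intro s
    rw [integral_smul_const, ← modularFn_integral μ s hh hhc, smul_smul,
      modularFn_inv]
    congr 1
    field_simp [(modularFn_pos s).ne']
  have sw1 : ∫ s, ∫ t, h (t * s) • f s⁻¹ ∂μ ∂μ = ∫ t, ∫ s, h (t * s) • f s⁻¹ ∂μ ∂μ := by
    refine integral_integral_swap_of_hasCompactSupport (f := fun s t => h (t * s) • f s⁻¹)
      (by simp only [Function.uncurry_def]; fun_prop) ?_
    apply HasCompactSupport.of_support_subset_isCompact
      (hc.isCompact.inv.prod (hhc.isCompact.mul hc.isCompact))
    rintro ⟨s, t⟩ hst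
    have hst' : h (t * s) • f s⁻¹ ≠ 0 := hst
    have a1 : s⁻¹ ∈ tsupport f := subset_tsupport _ fun z => hst' (by rw [z, smul_zero])
    have a2 : t * s ∈ tsupport h := subset_tsupport _ fun z => hst' (by rw [z, zero_smul])
    exact ⟨by simpa using a1, t * s, a2, s⁻¹, a1, by simp⟩
  have sw2 : ∫ t, ∫ s, h s • f (s⁻¹ * t) ∂μ ∂μ = ∫ s, ∫ t, h s • f (s⁻¹ * t) ∂μ ∂μ := by
    refine integral_integral_swap_of_hasCompactSupport (f := fun t s => h s • f (s⁻¹ * t))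
      (by simp only [Function.uncurry_def]; fun_prop) ?_
    apply HasCompactSupport.of_support_subset_isCompact
      ((hhc.isCompact.mul hc.isCompact).prod hhc.isCompact)
    rintro ⟨t, s⟩ hst
    have hst' : h s • f (s⁻¹ * t) ≠ 0 := hst
    have a1 : s⁻¹ * t ∈ tsupport f := subset_tsupport _ fun z => hst' (by rw [z, smul_zero])
    have a2 : s ∈ tsupport h := subset_tsupport _ fun z => hst' (by rw [z, zero_smul])
    exact ⟨⟨s, a2, s⁻¹ * t, a1, by simp⟩, a2⟩
  have e2 : (∫ t, h t ∂μ) • ∫ s, modularFn s⁻¹ • f s⁻¹ ∂μ = (∫ t, h t ∂μ) • ∫ s, f s ∂μ := by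
    calc (∫ t, h t ∂μ) • ∫ s, modularFn s⁻¹ • f s⁻¹ ∂μ
        = ∫ s, ∫ t, h (t * s) • f s⁻¹ ∂μ ∂μ := by
          rw [← integral_smul]
          exact integral_congr_ae (Eventually.of_forall e1)
      _ = ∫ t, ∫ s, h (t * s) • f s⁻¹ ∂μ ∂μ := sw1
      _ = ∫ t, ∫ s, h s • f (s⁻¹ * t) ∂μ ∂μ := by
          congr 1
          funext t
          rw [← integral_mul_left_eq_self _ t⁻¹]
          simp
      _ = ∫ s, ∫ t, h s • f (s⁻¹ * t) ∂μ ∂μ := sw2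
      _ = ∫ s, h s • ∫ t, f t ∂μ ∂μ := by
          congr 1
          funext s
          rw [integral_smul, integral_mul_left_eq_self f s⁻¹]
      _ = (∫ t, h t ∂μ) • ∫ s, f s ∂μ := integral_smul_const _ _
  exact smul_right_injective E hI.ne' e2

end Modular

section Involution

variable {𝕜 G A : Type*} [RCLike 𝕜] [Group G] [TopologicalSpace G] [IsTopologicalGroup G]
  [T2Space G] [LocallyCompactSpace G]
  [NonUnitalNormedRing A] [NormedSpace 𝕜 A] [CompleteSpace A]
  [StarRing A] [StarModule 𝕜 A] [ContinuousStar A] (α : DynSys 𝕜 G A)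

/-- The dynamical system is involutive: each `α_s` commutes with the involution. (That the
involution is bounded is the instance `ContinuousStar A`.) -/
def DynSys.Involutive : Prop := ∀ (s : G) (a : A), α.act s (star a) = star (α.act s a)

/-- `f^*(s) = Δ(s⁻¹) α_s(f(s⁻¹)^*)`. -/
def invol (f : C_c(G, A)) : C_c(G, A) where
  toFun s := ((modularFn s⁻¹ : ℝ) : 𝕜) • α.act s (star (f s⁻¹))
  continuous_toFun := by
    have h1 : Continuous fun s : G => ((modularFn s⁻¹ : ℝ) : 𝕜) :=
      RCLike.continuous_ofReal.comp (continuous_modularFn.comp continuous_inv)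
    have h2 : Continuous fun s : G => (s, star (f s⁻¹)) := by
      have := f.continuous
      fun_prop
    exact h1.smul ((joint_continuous α.act_cont).comp h2)
  hasCompactSupport' := by
    apply HasCompactSupport.of_support_subset_isCompact f.hasCompactSupport.isCompact.inv
    intro s hs
    have : s⁻¹ ∈ tsupport f := subset_tsupport _ fun z => hs (by simp [z])
    simpa using this

theorem invol_apply (f : C_c(G, A)) (s : G) :
    invol α f s = ((modularFn s⁻¹ : ℝ) : 𝕜) • α.act s (star (f s⁻¹)) := rfl

theorem invol_add (f g : C_c(G, A)) : invol α (f + g) = invol α f + invol α g := by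
  ext s
  simp [invol_apply]

theorem invol_smul (c : 𝕜) (f : C_c(G, A)) :
    invol α (c • f) = (starRingEnd 𝕜) c • invol α f := by
  ext s
  simp [invol_apply, star_smul, smul_smul, mul_comm]

end Involution

/-! ### The crossed product -/

/-- A uniformly bounded class of continuous covariant representations on Banach spaces. -/
structure UnifBddClass {𝕜 G A : Type*} [RCLike 𝕜] [Group G] [TopologicalSpace G]
    [NonUnitalNormedRing A] [NormedSpace 𝕜 A] (α : DynSys 𝕜 G A) where
  /-- the members of the class on a given Banach space -/
  mem : ∀ X : BanachSp.{w} 𝕜, Set (ContCovRep α X)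
  bdd : ∃ (C : ℝ≥0) (ν : G → ℝ≥0), (∀ K : Set G, IsCompact K → BddAbove (ν '' K)) ∧
    ∀ (X : BanachSp.{w} 𝕜), ∀ ρ ∈ mem X,
      (∀ a : A, ‖ρ.π a‖ ≤ C * ‖a‖) ∧ ∀ r : G, ‖ρ.U r‖ ≤ ν r

section CrossedProduct

variable {𝕜 G A : Type*} [RCLike 𝕜] [Group G] [TopologicalSpace G] [IsTopologicalGroup G]
  [T2Space G] [LocallyCompactSpace G] [MeasurableSpace G] [BorelSpace G]
  [NonUnitalNormedRing A] [NormedSpace 𝕜 A] [CompleteSpace A]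
  [IsScalarTower 𝕜 A A] [SMulCommClass 𝕜 A A]
  (μ : Measure G) [μ.IsHaarMeasure] {α : DynSys 𝕜 G A} (R : UnifBddClass.{w} α)

/-- The seminorm `σ^R(f) = sup_{(π, U) ∈ R} ‖(π ⋊ U)(f)‖`. -/
def sigma (f : C_c(G, A)) : ℝ :=
  ⨆ ρ : (Σ X : BanachSp.{w} 𝕜, R.mem X), ‖ρ.2.1.integrated μ f‖

theorem sigma_bdd (f : C_c(G, A)) :
    BddAbove (range fun ρ : (Σ X : BanachSp.{w} 𝕜, R.mem X) => ‖ρ.2.1.integrated μ f‖) := by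
  obtain ⟨C, ν, hν, hR⟩ := R.bdd
  obtain ⟨M, hM⟩ := hν _ f.hasCompactSupport
  refine ⟨C * M * ∫ s, ‖f s‖ ∂μ, ?_⟩
  rintro _ ⟨⟨X, ρ, hρ⟩, rfl⟩
  obtain ⟨h1, h2⟩ := hR X ρ hρ
  have h0 : 0 ≤ ∫ s, ‖f s‖ ∂μ := integral_nonneg fun _ => norm_nonneg _
  refine ContinuousLinearMap.opNorm_le_bound _ (by positivity) fun x => ?_
  exact ρ.norm_gint_integrand_le μ f x h1 C.2 fun s hs =>
    (h2 s).trans (NNReal.coe_le_coe.2 (hM ⟨s, hs, rfl⟩))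

theorem norm_integrated_le_sigma {X : BanachSp.{w} 𝕜} {ρ : ContCovRep α X} (hρ : ρ ∈ R.mem X)
    (f : C_c(G, A)) : ‖ρ.integrated μ f‖ ≤ sigma μ R f :=
  le_ciSup (sigma_bdd μ R f) ⟨X, ρ, hρ⟩

theorem sigma_nonneg (f : C_c(G, A)) : 0 ≤ sigma μ R f :=
  Real.iSup_nonneg fun _ => norm_nonneg _

theorem sigma_le {f : C_c(G, A)} {C : ℝ} (hC : 0 ≤ C)
    (h : ∀ (X : BanachSp.{w} 𝕜), ∀ ρ ∈ R.mem X, ‖ρ.integrated μ f‖ ≤ C) : sigma μ R f ≤ C :=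
  Real.iSup_le (fun ρ => h ρ.1 ρ.2.1 ρ.2.2) hC

theorem sigma_add (f g : C_c(G, A)) : sigma μ R (f + g) ≤ sigma μ R f + sigma μ R g :=
  sigma_le μ R (add_nonneg (sigma_nonneg μ R f) (sigma_nonneg μ R g)) fun X ρ hρ => by
    rw [ρ.integrated_add μ]
    exact (norm_add_le _ _).trans (add_le_add (norm_integrated_le_sigma μ R hρ f)
      (norm_integrated_le_sigma μ R hρ g))

theorem sigma_smul_le (c : 𝕜) (f : C_c(G, A)) : sigma μ R (c • f) ≤ ‖c‖ * sigma μ R f :=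
  sigma_le μ R (mul_nonneg (norm_nonneg c) (sigma_nonneg μ R f)) fun X ρ hρ => by
    rw [ρ.integrated_smul μ, norm_smul]
    exact mul_le_mul_of_nonneg_left (norm_integrated_le_sigma μ R hρ f) (norm_nonneg c)

theorem sigma_conv (f g : C_c(G, A)) :
    sigma μ R (conv μ α f g) ≤ sigma μ R f * sigma μ R g :=
  sigma_le μ R (mul_nonneg (sigma_nonneg μ R f) (sigma_nonneg μ R g)) fun X ρ hρ => by
    rw [ρ.integrated_conv μ]
    exact (norm_mul_le _ _).trans (mul_le_mul (norm_integrated_le_sigma μ R hρ f)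
      (norm_integrated_le_sigma μ R hρ g) (norm_nonneg _) (sigma_nonneg μ R f))

theorem sigma_zero : sigma μ R (0 : C_c(G, A)) = 0 := by
  refine le_antisymm ?_ (sigma_nonneg μ R _)
  simpa using sigma_smul_le μ R (0 : 𝕜) (0 : C_c(G, A))

theorem sigma_neg (f : C_c(G, A)) : sigma μ R (-f) = sigma μ R f := by
  have h : ∀ f : C_c(G, A), sigma μ R (-f) ≤ sigma μ R f := fun f => by
    simpa using sigma_smul_le μ R (-1 : 𝕜) f
  exact le_antisymm (h f) (by simpa using h (-f))

/-- The space `C_c(G, A)`, to be equipped with the seminorm `σ^R` and the twisted convolution. -/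
def PreCrossed (_ : Measure G) (_ : UnifBddClass.{w} α) : Type _ := C_c(G, A)

instance : AddCommGroup (PreCrossed μ R) := inferInstanceAs (AddCommGroup C_c(G, A))

instance : Module 𝕜 (PreCrossed μ R) := inferInstanceAs (Module 𝕜 C_c(G, A))

/-- `σ^R` as a seminorm on the additive group `C_c(G, A)`. -/
def sigmaSeminorm : AddGroupSeminorm (PreCrossed μ R) where
  toFun f := sigma (A := A) μ R f
  map_zero' := sigma_zero μ R
  add_le' f g := sigma_add μ R f g
  neg' f := sigma_neg μ R f

instance : SeminormedAddCommGroup (PreCrossed μ R) :=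
  (sigmaSeminorm μ R).toSeminormedAddCommGroup

instance : NormedSpace 𝕜 (PreCrossed μ R) where
  norm_smul_le c f := sigma_smul_le μ R c f

theorem preCrossed_norm (f : PreCrossed μ R) : ‖f‖ = sigma (A := A) μ R f := rfl

/-- The crossed product `(A ⋊_α G)^R`: the Hausdorff completion of `C_c(G, A)` for `σ^R`, that is,
the completion of `C_c(G, A) / ker σ^R` in the norm induced by `σ^R`. -/
def CrossedProduct : Type _ := UniformSpace.Completion (PreCrossed μ R)

namespace CrossedProduct

instance : NormedAddCommGroup (CrossedProduct μ R) :=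
  inferInstanceAs (NormedAddCommGroup (UniformSpace.Completion (PreCrossed μ R)))

instance : NormedSpace 𝕜 (CrossedProduct μ R) :=
  inferInstanceAs (NormedSpace 𝕜 (UniformSpace.Completion (PreCrossed μ R)))

instance : CompleteSpace (CrossedProduct μ R) :=
  inferInstanceAs (CompleteSpace (UniformSpace.Completion (PreCrossed μ R)))

/-- The canonical map `q^R : C_c(G, A) → (A ⋊_α G)^R`. -/
def q : C_c(G, A) →ₗ[𝕜] CrossedProduct μ R :=
  (UniformSpace.Completion.toComplL (𝕜 := 𝕜) (E := PreCrossed μ R)).toLinearMap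

theorem norm_q (f : C_c(G, A)) : ‖q μ R f‖ = sigma μ R f :=
  UniformSpace.Completion.norm_coe (E := PreCrossed μ R) f

theorem denseRange_q : DenseRange (q μ R) :=
  UniformSpace.Completion.denseRange_coe (α := PreCrossed μ R)

variable {μ R} in
theorem induction {p : CrossedProduct μ R → Prop} (c : CrossedProduct μ R)
    (hc : IsClosed {c | p c}) (h : ∀ f : C_c(G, A), p (q μ R f)) : p c :=
  isClosed_property (denseRange_q μ R) hc h c

/-- The twisted convolution as a bilinear map into the completion. -/
def convBil : C_c(G, A) →ₗ[𝕜] C_c(G, A) →ₗ[𝕜] CrossedProduct μ R :=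
  LinearMap.mk₂ 𝕜 (fun f g => q μ R (conv μ α f g))
    (fun f g h => by rw [add_conv, map_add])
    (fun c f g => by rw [smul_conv, map_smul])
    (fun f g h => by rw [conv_add, map_add])
    (fun c f g => by rw [conv_smul, map_smul])

theorem convBil_apply (f g : C_c(G, A)) : convBil μ R f g = q μ R (conv μ α f g) := rfl

theorem norm_convBil_le (f g : C_c(G, A)) : ‖convBil μ R f g‖ ≤ sigma μ R f * ‖q μ R g‖ := by
  rw [convBil_apply, norm_q, norm_q]
  exact sigma_conv μ R f g

/-- Left multiplication by `q^R(f)`: the continuous extension of `q^R(g) ↦ q^R(f * g)`. -/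
def leftMul : C_c(G, A) →ₗ[𝕜] (CrossedProduct μ R →L[𝕜] CrossedProduct μ R) where
  toFun f := (convBil μ R f).extendOfNorm (q μ R)
  map_add' f g := by
    refine LinearMap.extendOfNorm_unique (denseRange_q μ R) _ (norm_convBil_le μ R (f + g)) _ ?_
    ext h
    simp [LinearMap.extendOfNorm_eq (denseRange_q μ R) ⟨_, norm_convBil_le μ R _⟩]
  map_smul' c f := by
    refine LinearMap.extendOfNorm_unique (denseRange_q μ R) _ (norm_convBil_le μ R (c • f)) _ ?_
    ext h
    simp [LinearMap.extendOfNorm_eq (denseRange_q μ R) ⟨_, norm_convBil_le μ R _⟩]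

theorem leftMul_q (f g : C_c(G, A)) : leftMul μ R f (q μ R g) = q μ R (conv μ α f g) :=
  LinearMap.extendOfNorm_eq (denseRange_q μ R) ⟨_, norm_convBil_le μ R f⟩ g

theorem norm_leftMul_le (f : C_c(G, A)) : ‖leftMul μ R f‖ ≤ 1 * ‖q μ R f‖ := by
  rw [one_mul, norm_q]
  exact LinearMap.opNorm_extendOfNorm_le (denseRange_q μ R) (sigma_nonneg μ R f)
    (norm_convBil_le μ R f)

/-- The multiplication of the crossed product: the continuous bilinear extension of
`(q^R(f), q^R(g)) ↦ q^R(f * g)`. -/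
def mulL : CrossedProduct μ R →L[𝕜] CrossedProduct μ R →L[𝕜] CrossedProduct μ R :=
  (leftMul μ R).extendOfNorm (q μ R)

instance : Mul (CrossedProduct μ R) := ⟨fun a b => mulL μ R a b⟩

theorem mul_def (a b : CrossedProduct μ R) : a * b = mulL μ R a b := rfl

theorem q_mul (f g : C_c(G, A)) : q μ R f * q μ R g = q μ R (conv μ α f g) := by
  rw [mul_def, mulL, LinearMap.extendOfNorm_eq (denseRange_q μ R) ⟨1, norm_leftMul_le μ R⟩,
    leftMul_q]

theorem norm_mul_le' (a b : CrossedProduct μ R) : ‖a * b‖ ≤ ‖a‖ * ‖b‖ := by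
  have h := LinearMap.norm_extendOfNorm_apply_le (denseRange_q μ R) 1 (norm_leftMul_le μ R) a
  rw [one_mul] at h
  exact ((mulL μ R a).le_opNorm b).trans (mul_le_mul_of_nonneg_right h (norm_nonneg b))

theorem q_assoc (f g h : C_c(G, A)) :
    q μ R (conv μ α (conv μ α f g) h) = q μ R (conv μ α f (conv μ α g h)) := by
  rw [← sub_eq_zero, ← map_sub, ← norm_eq_zero, norm_q]
  refine le_antisymm (sigma_le μ R le_rfl fun X ρ _ => ?_) (sigma_nonneg μ R _)
  rw [sub_eq_add_neg, ← neg_one_smul 𝕜 (conv μ α f (conv μ α g h)), ρ.integrated_add μ,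
    ρ.integrated_smul μ, ρ.integrated_conv μ, ρ.integrated_conv μ, ρ.integrated_conv μ,
    ρ.integrated_conv μ, mul_assoc]
  simp

theorem mul_assoc' (a b c : CrossedProduct μ R) : a * b * c = a * (b * c) := by
  simp only [mul_def]
  induction a using induction with
  | hc => exact isClosed_eq (by fun_prop) (by fun_prop)
  | h f =>
  induction b using induction with
  | hc => exact isClosed_eq (by fun_prop) (by fun_prop)
  | h g =>
  induction c using induction with
  | hc => exact isClosed_eq (by fun_prop) (by fun_prop)
  | h h => simp only [← mul_def, q_mul, q_assoc]

/-- The crossed product is a Banach algebra. -/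
instance : NonUnitalNormedRing (CrossedProduct μ R) :=
  { (inferInstance : NormedAddCommGroup (CrossedProduct μ R)),
    (inferInstance : Mul (CrossedProduct μ R)) with
    left_distrib := fun a b c => map_add (mulL μ R a) b c
    right_distrib := fun a b c => by simp [mul_def]
    zero_mul := fun a => by simp [mul_def]
    mul_zero := fun a => by simp [mul_def]
    mul_assoc := mul_assoc' μ R
    norm_mul_le := norm_mul_le' μ R }

instance : IsScalarTower 𝕜 (CrossedProduct μ R) (CrossedProduct μ R) where
  smul_assoc c a b := by
    change mulL μ R (c • a) b = c • mulL μ R a b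
    simp

instance : SMulCommClass 𝕜 (CrossedProduct μ R) (CrossedProduct μ R) where
  smul_comm c a b := by
    change c • mulL μ R a b = mulL μ R a (c • b)
    simp

end CrossedProduct

/-- The integrated form as a linear map on `C_c(G, A)`. -/
def ContCovRep.integratedLin {X : Type*} [NormedAddCommGroup X] [NormedSpace 𝕜 X]
    [CompleteSpace X] (ρ : ContCovRep α X) : C_c(G, A) →ₗ[𝕜] (X →L[𝕜] X) where
  toFun f := ρ.integrated μ f
  map_add' := ρ.integrated_add μ
  map_smul' := ρ.integrated_smul μ

variable {R}

theorem norm_integratedLin_le {X : BanachSp.{w} 𝕜} {ρ : ContCovRep α X} (hρ : ρ ∈ R.mem X)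
    (f : C_c(G, A)) : ‖ρ.integratedLin μ f‖ ≤ 1 * ‖CrossedProduct.q μ R f‖ := by
  rw [one_mul, CrossedProduct.norm_q]
  exact norm_integrated_le_sigma μ R hρ f

theorem extend_integratedLin_q {X : BanachSp.{w} 𝕜} {ρ : ContCovRep α X} (hρ : ρ ∈ R.mem X)
    (f : C_c(G, A)) : (ρ.integratedLin μ).extendOfNorm (CrossedProduct.q μ R)
      (CrossedProduct.q μ R f) = ρ.integrated μ f :=
  LinearMap.extendOfNorm_eq (CrossedProduct.denseRange_q μ R)
    ⟨1, norm_integratedLin_le μ hρ⟩ f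

/-- For `(π, U) ∈ R`, the representation `(π ⋊ U)^R` of the crossed product: the continuous
extension of `q^R(f) ↦ (π ⋊ U)(f)`. -/
def integratedRep {X : BanachSp.{w} 𝕜} (ρ : R.mem X) :
    CrossedProduct μ R →ₙₐ[𝕜] (X →L[𝕜] X) where
  toFun c := (ρ.1.integratedLin μ).extendOfNorm (CrossedProduct.q μ R) c
  map_smul' k c := map_smul _ k c
  map_zero' := map_zero _
  map_add' c d := map_add _ c d
  map_mul' c d := by
    set E := (ρ.1.integratedLin μ).extendOfNorm (CrossedProduct.q μ R)
    simp only [CrossedProduct.mul_def]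
    induction c using CrossedProduct.induction with
    | hc => exact isClosed_eq (by fun_prop) (by fun_prop)
    | h f =>
    induction d using CrossedProduct.induction with
    | hc => exact isClosed_eq (by fun_prop) (by fun_prop)
    | h g =>
    rw [← CrossedProduct.mul_def, CrossedProduct.q_mul, extend_integratedLin_q μ ρ.2,
      extend_integratedLin_q μ ρ.2, extend_integratedLin_q μ ρ.2, ρ.1.integrated_conv μ]

/-- `(π ⋊ U)^R(q^R(f)) = (π ⋊ U)(f)`. -/
theorem integratedRep_q {X : BanachSp.{w} 𝕜} (ρ : R.mem X) (f : C_c(G, A)) :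
    integratedRep μ ρ (CrossedProduct.q μ R f) = ρ.1.integrated μ f :=
  extend_integratedLin_q μ ρ.2 f

section Star

variable (R) [StarRing A] [StarModule 𝕜 A] [ContinuousStar A]

/-- `f ↦ q^R(f^*)`, a conjugate-linear map. -/
def involLin : C_c(G, A) →ₛₗ[starRingEnd 𝕜] CrossedProduct μ R where
  toFun f := CrossedProduct.q μ R (invol α f)
  map_add' f g := by rw [invol_add, map_add]
  map_smul' c f := by rw [invol_smul, map_smul]

/-- The involution of the crossed product: the continuous conjugate-linear extension of
`q^R(f) ↦ q^R(f^*)`. It exists, and is isometric, if `(A, G, α)` and `R` are involutive. -/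
def CrossedProduct.invol (c : CrossedProduct μ R) : CrossedProduct μ R :=
  (involLin μ R).extendOfNorm (CrossedProduct.q μ R) c

/-- In the involutive case, `(π ⋊ U)(f^*)` is the adjoint of `(π ⋊ U)(f)`. -/
theorem inner_integrated_invol {X : Type*} [NormedAddCommGroup X] [InnerProductSpace 𝕜 X]
    [CompleteSpace X] (ρ : ContCovRep α X)
    (hπ : ∀ (a : A) (x y : X), inner 𝕜 (ρ.π a x) y = inner 𝕜 x (ρ.π (star a) y))
    (hU : ∀ (r : G) (x y : X), inner 𝕜 (ρ.U r x) (ρ.U r y) = inner 𝕜 x y)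
    (f : C_c(G, A)) (x y : X) :
    inner 𝕜 y (ρ.integrated μ (BanachCP.invol α f) x) = inner 𝕜 (ρ.integrated μ f y) x := by
  set g : G → 𝕜 := fun s => inner 𝕜 (ρ.integrand f y s) x with hg
  have hgc : Continuous g := (ρ.continuous_integrand f y).inner continuous_const
  have hgs : HasCompactSupport g := (ρ.compact_integrand f y).mono fun s hs h0 => hs (by
    simp only [Function.mem_support, hg] at *
    rw [h0, inner_zero_left])
  have e1 : ∀ s, inner 𝕜 y (ρ.integrand (BanachCP.invol α f) x s) = modularFn s⁻¹ • g s⁻¹ := by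
    intro s
    have h1 : ρ.integrand (BanachCP.invol α f) x s =
        ((modularFn s⁻¹ : ℝ) : 𝕜) • ρ.U s (ρ.π (star (f s⁻¹)) x) := by
      rw [ContCovRep.integrand, invol_apply, map_smul, smul_apply,
        ρ.cov_apply]
    have h2 : y = ρ.U s (ρ.U s⁻¹ y) := by
      rw [← ρ.U_mul_apply]; simp
    rw [h1, inner_smul_right, RCLike.real_smul_eq_coe_mul]
    congr 1
    conv_lhs => rw [h2]
    rw [hU, ← hπ]
    rfl
  have e2 : inner 𝕜 y (ρ.integrated μ (BanachCP.invol α f) x) =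
      ∫ s, inner 𝕜 y (ρ.integrand (BanachCP.invol α f) x s) ∂μ := by
    rw [← gint_eq_integral]
    exact (gint_comm (innerSL 𝕜 y) (ρ.integrable_integrand μ _ x)).symm
  have e3 : inner 𝕜 x (ρ.integrated μ f y) = ∫ s, inner 𝕜 x (ρ.integrand f y s) ∂μ := by
    rw [← gint_eq_integral]
    exact (gint_comm (innerSL 𝕜 x) (ρ.integrable_integrand μ _ y)).symm
  rw [e2, integral_congr_ae (Eventually.of_forall e1), integral_modularFn_inv μ hgc hgs,
    ← inner_conj_symm, e3, ← integral_conj]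
  simp [hg]

theorem norm_integrated_invol_le {X : Type*} [NormedAddCommGroup X] [NormedSpace 𝕜 X]
    [CompleteSpace X] (ρ : ContCovRep α X) (hρ : ρ.Involutive)
    (f : C_c(G, A)) : ‖ρ.integrated μ (BanachCP.invol α f)‖ ≤ ‖ρ.integrated μ f‖ := by
  obtain ⟨H, rfl, hπ, hU⟩ := hρ
  refine ContinuousLinearMap.opNorm_le_bound _ (norm_nonneg _) fun x => ?_
  set z := ρ.integrated μ (BanachCP.invol α f) x
  have h := inner_integrated_invol μ ρ hπ hU f x z
  have h2 : ‖z‖ * ‖z‖ ≤ ‖ρ.integrated μ f‖ * ‖x‖ * ‖z‖ := by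
    calc ‖z‖ * ‖z‖ = ‖(inner 𝕜 z z : 𝕜)‖ := by
          rw [← sq, inner_self_eq_norm_sq_to_K]; simp
      _ = ‖(inner 𝕜 (ρ.integrated μ f z) x : 𝕜)‖ := by rw [h]
      _ ≤ ‖ρ.integrated μ f z‖ * ‖x‖ := norm_inner_le_norm _ _
      _ ≤ (‖ρ.integrated μ f‖ * ‖z‖) * ‖x‖ := by gcongr; exact ContinuousLinearMap.le_opNorm _ _
      _ = ‖ρ.integrated μ f‖ * ‖x‖ * ‖z‖ := by ring
  rcases (norm_nonneg z).eq_or_lt with h0 | h0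
  · rw [← h0]; positivity
  · exact le_of_mul_le_mul_right h2 h0

/-- If all members of `R` are involutive, then `q^R(f)^* = q^R(f^*)`. -/
theorem CrossedProduct.invol_q
    (hR : ∀ (X : BanachSp.{w} 𝕜), ∀ ρ ∈ R.mem X, ρ.Involutive) (f : C_c(G, A)) :
    CrossedProduct.invol μ R (CrossedProduct.q μ R f) =
      CrossedProduct.q μ R (BanachCP.invol α f) := by
  refine LinearMap.extendOfNorm_eq (CrossedProduct.denseRange_q μ R) ⟨1, fun g => ?_⟩ f
  change ‖CrossedProduct.q μ R (BanachCP.invol α g)‖ ≤ 1 * ‖CrossedProduct.q μ R g‖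
  rw [one_mul, norm_q, norm_q]
  exact sigma_le μ R (sigma_nonneg μ R g) fun X ρ hρ =>
    (norm_integrated_invol_le μ ρ (hR X ρ hρ) g).trans (norm_integrated_le_sigma μ R hρ g)

end Star

/-- The class `R'` on a given space: all non-degenerate continuous covariant representations
`(π, U)` with `π` contractive and `‖U_r‖ ≤ ν(r)` for all `r`. -/
def boundedReps (α : DynSys 𝕜 G A) (ν : G → ℝ≥0) (X : Type*) [NormedAddCommGroup X]
    [NormedSpace 𝕜 X] : Set (ContCovRep α X) :=
  {ρ | RepNonDegenerate ρ.π ∧ RepContractive ρ.π ∧ ∀ r : G, ‖ρ.U r‖ ≤ ν r}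

end CrossedProduct

end

end BanachCP

open BanachCP

/-! Write `B` for the crossed product. Both `A` and `G` act on `B` by left multipliers, extending `f
↦ a f` and `f ↦ α_r(f(r⁻¹ ·))`. In every member of the class these become left multiplication by
`π(a)` and `U_r`, so their norms are at most `‖a‖` and `ν(r)` (`norm_algMult_le`,
`norm_groupMult_le`).

The algebra `B` inherits a `(1+ε)`-bounded left approximate identity for each `ε > 0`: take `φ ⊗ u`
with `φ` a normalised bump at the identity of `G` and `u` from an approximate identity of `A`. The
condition on `ν` near the identity keeps the norm close to 1 (`hasBddLeftApproxId_crossedProduct`).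

A non-degenerate contractive representation `T` of `B` then extends to left multipliers by `T b x ↦
T (L b) x`. Since `T (L b) x` is the limit of `T (L e) (T b x)` along such approximate identities,
the extension is well defined with norm at most `‖L‖`, with no loss of constant
(`norm_evalTensor_le`). Applied to the multipliers from `A` and `G` this yields a covariant pair
obeying the same bounds, hence in the class. Its integrated form is `T`, because `q(f * g) = ∫ f(s)
· (s · q(g)) ds` (`integrated_disintegrate`). This is surjectivity.

Conversely, an integrated form satisfies `T (a · c) = π(a) T c` and `T (r · c) = U_r T c`. By
non-degeneracy these identities recover the pair from `T`. They carry intertwiners back, and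
injectivity is the case of the identity operator. Together with `T e → 1` strongly they carry closed
invariant subspaces back. In the opposite direction, invariance, intertwining and adjoints pass
through the integral and extend from `C_c(G, A)` by continuity. -/

namespace BanachCP

noncomputable section

/-! ### Strong convergence on a dense set -/

section Dense

variable {𝕜 : Type*} [RCLike 𝕜] {X : Type*} [NormedAddCommGroup X] [NormedSpace 𝕜 X]
  {Y : Type*} [NormedAddCommGroup Y] [NormedSpace 𝕜 Y]

/-- A bounded net of operators that converges pointwise on a set with dense span converges
pointwise everywhere. -/
theorem tendsto_of_dense_span {ι : Type*} {l : Filter ι} {S : ι → X →L[𝕜] Y} {S₀ : X →L[𝕜] Y}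
    {M : ℝ} (hM : ∀ᶠ i in l, ‖S i‖ ≤ M) {D : Set X} (hD : Dense (Submodule.span 𝕜 D : Set X))
    (h : ∀ x ∈ D, Tendsto (fun i => S i x) l (𝓝 (S₀ x))) (x : X) :
    Tendsto (fun i => S i x) l (𝓝 (S₀ x)) := by
  have hs : ∀ y ∈ Submodule.span 𝕜 D, Tendsto (fun i => S i y) l (𝓝 (S₀ y)) := by
    intro y hy
    induction hy using Submodule.span_induction with
    | mem y hy => exact h y hy
    | zero => simp [tendsto_const_nhds]
    | add y z _ _ hy hz => simpa using hy.add hz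
    | smul c y _ hy => simpa using hy.const_smul c
  rw [Metric.tendsto_nhds]
  intro δ hδ
  -- `C` dominates the norm of `S i - S₀`; the extra 1 keeps it positive, so that one may divide by
  -- it.
  set C : ℝ := |M| + ‖S₀‖ + 1 with hC
  have hC0 : 0 < C := by positivity
  obtain ⟨y, hxy, hy⟩ := Metric.dense_iff.1 hD x (δ / (2 * C)) (by positivity)
  rw [Metric.mem_ball, dist_eq_norm] at hxy
  filter_upwards [hM, Metric.tendsto_nhds.1 (hs y hy) (δ / 2) (by positivity)] with i hi hiy
  rw [dist_eq_norm] at hiy ⊢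
  have e : S i x - S₀ x = (S i y - S₀ y) - (S i - S₀) (y - x) := by
    simp only [sub_apply, map_sub]
    abel
  have h1 : ‖(S i - S₀) (y - x)‖ ≤ δ / 2 := by
    calc ‖(S i - S₀) (y - x)‖ ≤ ‖S i - S₀‖ * ‖y - x‖ := ContinuousLinearMap.le_opNorm _ _
      _ ≤ C * (δ / (2 * C)) := by
        gcongr
        refine (norm_sub_le _ _).trans ?_
        have := le_abs_self M
        rw [hC]
        linarith
      _ = δ / 2 := by field_simp
  rw [e]
  exact (norm_sub_le _ _).trans_lt (by linarith)

end Dense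

/-! ### Representations and multipliers -/

section Multipliers

variable {𝕜 : Type*} [RCLike 𝕜] {B : Type*} [NonUnitalNormedRing B] [NormedSpace 𝕜 B]
  {X : Type*} [NormedAddCommGroup X] [NormedSpace 𝕜 X]
  {Y : Type*} [NormedAddCommGroup Y] [NormedSpace 𝕜 Y]

theorem RepNonDegenerate.clm_ext {T : B →ₙₐ[𝕜] (X →L[𝕜] X)} (hT : RepNonDegenerate T)
    {S S' : X →L[𝕜] Y} (h : ∀ b x, S (T b x) = S' (T b x)) : S = S' := by
  refine ContinuousLinearMap.ext_on hT ?_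
  rintro _ ⟨b, x, rfl⟩
  exact h b x

/-- A representation is non-degenerate if all vectors of some non-degenerate set are limits of
vectors `T b x`. -/
theorem RepNonDegenerate.of_mem_closure {T : B →ₙₐ[𝕜] (X →L[𝕜] X)} {D : Set X}
    (hD : Dense (Submodule.span 𝕜 D : Set X))
    (h : ∀ x ∈ D, x ∈ closure {y : X | ∃ (b : B) (x : X), y = T b x}) : RepNonDegenerate T := by
  have h1 : Submodule.span 𝕜 D ≤
      (Submodule.span 𝕜 {y : X | ∃ (b : B) (x : X), y = T b x}).topologicalClosure := by
    rw [Submodule.span_le]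
    exact fun x hx => closure_mono Submodule.subset_span (h x hx)
  have h2 := hD.mono h1
  rw [Submodule.topologicalClosure_coe] at h2
  exact dense_closure.1 h2

/-- A contractive representation as a bounded operator. -/
def repL (T : B →ₙₐ[𝕜] (X →L[𝕜] X)) (hT : RepContractive T) : B →L[𝕜] (X →L[𝕜] X) :=
  LinearMap.mkContinuous
    { toFun := fun b => T b
      map_add' := map_add T
      map_smul' := fun c b => map_smul T c b } 1 (fun b => by simpa using hT b)

@[simp] theorem repL_apply (T : B →ₙₐ[𝕜] (X →L[𝕜] X)) (hT : RepContractive T) (b : B) :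
    repL T hT b = T b := rfl

/-- In a non-degenerate contractive representation, a bounded left approximate identity converges
strongly to the identity. -/
theorem RepNonDegenerate.tendsto_approxId {T : B →ₙₐ[𝕜] (X →L[𝕜] X)} (hT : RepNonDegenerate T)
    (hc : RepContractive T) {l : Filter B} {M : ℝ} (hM : ∀ᶠ e in l, ‖e‖ ≤ M)
    (hl : ∀ b : B, Tendsto (fun e => e * b) l (𝓝 b)) (x : X) :
    Tendsto (fun e => T e x) l (𝓝 x) := by
  refine tendsto_of_dense_span (S := fun e => T e) (S₀ := ContinuousLinearMap.id 𝕜 X) (M := M)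
    ?_ hT ?_ x
  · filter_upwards [hM] with e he using (hc e).trans he
  · rintro _ ⟨b, y, rfl⟩
    have h1 : Tendsto (fun e => repL T hc (e * b) y) l (𝓝 (repL T hc b y)) :=
      (((repL T hc).flip y).continuous.tendsto b).comp (hl b)
    simpa using h1

/-- The linear map `b ⊗ x ↦ S b x`. -/
def evalTensor (S : B →L[𝕜] (X →L[𝕜] X)) : TensorProduct 𝕜 B X →ₗ[𝕜] X :=
  TensorProduct.lift (ContinuousLinearMap.coeLM 𝕜 ∘ₗ S.toLinearMap)

@[simp] theorem evalTensor_tmul (S : B →L[𝕜] (X →L[𝕜] X)) (b : B) (x : X) :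
    evalTensor S (b ⊗ₜ[𝕜] x) = S b x := rfl

theorem denseRange_evalTensor {T : B →ₙₐ[𝕜] (X →L[𝕜] X)} (hT : RepNonDegenerate T)
    (hc : RepContractive T) : DenseRange (evalTensor (repL T hc)) := by
  refine Dense.mono (s₁ := (Submodule.span 𝕜 {y : X | ∃ (b : B) (x : X), y = T b x} : Set X)) ?_ hT
  have : Submodule.span 𝕜 {y : X | ∃ (b : B) (x : X), y = T b x} ≤
      LinearMap.range (evalTensor (repL T hc)) := by
    rw [Submodule.span_le]
    rintro _ ⟨b, x, rfl⟩
    exact ⟨b ⊗ₜ[𝕜] x, by simp⟩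
  exact this

/-- For `t = ∑ bᵢ ⊗ xᵢ`, the vector `∑ T (L bᵢ) xᵢ` is the limit of `T (L e) (∑ T bᵢ xᵢ)`, because
`L e * bᵢ = L (e * bᵢ) → L bᵢ`. This gives the bound with a factor `1 + ε`, which disappears as `ε →
0`. Well-definedness of `T b x ↦ T (L b) x` on sums is part of the estimate. -/
theorem norm_evalTensor_le {T : B →ₙₐ[𝕜] (X →L[𝕜] X)} (hc : RepContractive T)
    (hB : ∀ ε : ℝ, 0 < ε → HasBddLeftApproxId B (1 + ε)) {L : B →L[𝕜] B}
    (hL : ∀ b c, L (b * c) = L b * c) (t : TensorProduct 𝕜 B X) :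
    ‖evalTensor (repL T hc ∘L L) t‖ ≤ ‖L‖ * ‖evalTensor (repL T hc) t‖ := by
  have key : ∀ ε : ℝ, 0 < ε → ‖evalTensor (repL T hc ∘L L) t‖ ≤
      ‖L‖ * (1 + ε) * ‖evalTensor (repL T hc) t‖ := by
    intro ε hε
    obtain ⟨l, hne, hM, hl⟩ := hB ε hε
    have lim : Tendsto (fun e => T (L e) (evalTensor (repL T hc) t)) l
        (𝓝 (evalTensor (repL T hc ∘L L) t)) := by
      induction t using TensorProduct.induction_on with
      | zero => simp
      | tmul b x =>
        have h1 : Tendsto (fun e => repL T hc (L (e * b)) x) l (𝓝 (repL T hc (L b) x)) :=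
          (((repL T hc ∘L L).flip x).continuous.tendsto b).comp (hl b)
        simpa [hL] using h1
      | add t u ht hu => simpa using ht.add hu
    refine le_of_tendsto lim.norm ?_
    filter_upwards [hM] with e he
    refine (ContinuousLinearMap.le_opNorm _ _).trans ?_
    gcongr
    calc ‖T (L e)‖ ≤ ‖L e‖ := hc _
      _ ≤ ‖L‖ * ‖e‖ := L.le_opNorm e
      _ ≤ ‖L‖ * (1 + ε) := by gcongr
  have lim : Tendsto (fun ε : ℝ => ‖L‖ * (1 + ε) * ‖evalTensor (repL T hc) t‖) (𝓝[>] 0)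
      (𝓝 (‖L‖ * (1 + 0) * ‖evalTensor (repL T hc) t‖)) :=
    ((by fun_prop : Continuous fun ε : ℝ => ‖L‖ * (1 + ε) * ‖evalTensor (repL T hc) t‖).tendsto
      0).mono_left nhdsWithin_le_nhds
  have := ge_of_tendsto lim (eventually_nhdsWithin_of_forall fun ε hε => key ε hε)
  simpa using this

variable [CompleteSpace X]

/-- The operator `T b x ↦ T (L b) x` on the space of a representation `T` of `B`, for a left
multiplier `L` of `B`. -/
def multExt (T : B →ₙₐ[𝕜] (X →L[𝕜] X)) (hc : RepContractive T) (L : B →L[𝕜] B) : X →L[𝕜] X :=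
  (evalTensor (repL T hc ∘L L)).extendOfNorm (evalTensor (repL T hc))

theorem multExt_apply {T : B →ₙₐ[𝕜] (X →L[𝕜] X)} (hT : RepNonDegenerate T) (hc : RepContractive T)
    (hB : ∀ ε : ℝ, 0 < ε → HasBddLeftApproxId B (1 + ε)) {L : B →L[𝕜] B}
    (hL : ∀ b c, L (b * c) = L b * c) (b : B) (x : X) :
    multExt T hc L (T b x) = T (L b) x :=
  LinearMap.extendOfNorm_eq (denseRange_evalTensor hT hc)
    ⟨‖L‖, norm_evalTensor_le hc hB hL⟩ (b ⊗ₜ[𝕜] x)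

theorem norm_multExt_le {T : B →ₙₐ[𝕜] (X →L[𝕜] X)} (hT : RepNonDegenerate T)
    (hc : RepContractive T) (hB : ∀ ε : ℝ, 0 < ε → HasBddLeftApproxId B (1 + ε)) {L : B →L[𝕜] B}
    (hL : ∀ b c, L (b * c) = L b * c) : ‖multExt T hc L‖ ≤ ‖L‖ :=
  LinearMap.opNorm_extendOfNorm_le (denseRange_evalTensor hT hc) (norm_nonneg L)
    (norm_evalTensor_le hc hB hL)

end Multipliers


/-! ### Approximate identities on the group -/

section Bumps

variable {G : Type*} [Group G] [TopologicalSpace G] [MeasurableSpace G]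

/-- The filter of normalised non-negative functions in `C_c(G)` supported close to the identity. -/
def bumps (μ : Measure G) : Filter C_c(G, ℝ) :=
  (𝓝 (1 : G)).lift' fun W => {φ | (∀ s, 0 ≤ φ s) ∧ ∫ s, φ s ∂μ = 1 ∧ ∀ s, s ∉ W → φ s = 0}

theorem eventually_bumps (μ : Measure G) {W : Set G} (hW : W ∈ 𝓝 (1 : G)) :
    ∀ᶠ φ in bumps μ, (∀ s, 0 ≤ φ s) ∧ ∫ s, φ s ∂μ = 1 ∧ ∀ s, s ∉ W → φ s = 0 :=
  mem_lift' hW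

variable [IsTopologicalGroup G] [T2Space G] [LocallyCompactSpace G] [BorelSpace G]
  (μ : Measure G) [μ.IsHaarMeasure]

/-- Urysohn's lemma gives a function equal to 1 at the identity and vanishing off the interior of
`W`. Its Haar integral is positive, so it can be normalised. -/
instance : (bumps μ).NeBot := by
  unfold bumps
  rw [lift'_neBot_iff]
  · intro W hW
    obtain ⟨f, hf1, hf0, hfc, hf01⟩ := exists_continuous_one_zero_of_isCompact
      (isCompact_singleton (x := (1 : G))) (isOpen_interior (s := W)).isClosed_compl
      (by simpa using mem_interior_iff_mem_nhds.2 hW)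
    have hpos : 0 < ∫ s, f s ∂μ :=
      f.continuous.integral_pos_of_hasCompactSupport_nonneg_nonzero hfc (fun s => (hf01 s).1)
        (x := 1) (by rw [hf1 rfl]; simp)
    refine ⟨⟨⟨fun s => (∫ s, f s ∂μ)⁻¹ * f s, by fun_prop⟩, hfc.mul_left⟩, ?_, ?_, ?_⟩
    · intro s
      exact mul_nonneg (inv_nonneg.2 hpos.le) (hf01 s).1
    · change ∫ s, (∫ s, f s ∂μ)⁻¹ * f s ∂μ = 1
      rw [integral_const_mul, inv_mul_cancel₀ hpos.ne']
    · intro s hs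
      have : f s = 0 := hf0 fun h => hs (interior_subset h)
      change (∫ s, f s ∂μ)⁻¹ * f s = 0
      rw [this, mul_zero]
  · intro V W hVW φ hφ
    exact ⟨hφ.1, hφ.2.1, fun s hs => hφ.2.2 s fun h => hs (hVW h)⟩

variable {𝕜 : Type*} [RCLike 𝕜] {X : Type*} [NormedAddCommGroup X] [NormedSpace 𝕜 X]
  [CompleteSpace X]

/-- `φ μ` is a probability measure, and an average of values within `δ` of `x` is within `δ` of `x`.
The case `x = 0` serves for norm bounds, the general case for convergence. -/
theorem norm_gint_bump_sub_le {φ : C_c(G, ℝ)} (h0 : ∀ s, 0 ≤ φ s) (h1 : ∫ s, φ s ∂μ = 1)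
    {F : G → X} (hF : Continuous F) {x : X} {δ : ℝ} (hδ : ∀ s, φ s ≠ 0 → ‖F s - x‖ ≤ δ) :
    ‖gint 𝕜 μ (fun s => (φ s : 𝕜) • F s) - x‖ ≤ δ := by
  letI : NormedSpace ℝ X := NormedSpace.restrictScalars ℝ 𝕜 X
  have hφ : Integrable φ μ := φ.continuous.integrable_of_hasCompactSupport φ.hasCompactSupport
  have e1 : ∀ (s : G) (y : X), (φ s : 𝕜) • y = φ s • y := fun s y => rfl
  have hi1 : Integrable (fun s => φ s • F s) μ :=
    (φ.continuous.smul hF).integrable_of_hasCompactSupport φ.hasCompactSupport.smul_right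
  have hi2 : Integrable (fun s => φ s • x) μ := hφ.smul_const x
  have e2 : gint 𝕜 μ (fun s => (φ s : 𝕜) • F s) - x = ∫ s, φ s • (F s - x) ∂μ := by
    have : ∫ s, φ s • x ∂μ = x := by rw [integral_smul_const, h1, one_smul]
    conv_lhs => rw [← this]
    simp only [smul_sub]
    exact (integral_sub hi1 hi2).symm
  rw [e2]
  calc ‖∫ s, φ s • (F s - x) ∂μ‖ ≤ ∫ s, ‖φ s • (F s - x)‖ ∂μ := norm_integral_le_integral_norm _
    _ ≤ ∫ s, φ s * δ ∂μ := by
      refine integral_mono ?_ (hφ.mul_const δ) fun s => ?_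
      · simp only [smul_sub]
        exact (hi1.sub hi2).norm
      · simp only [norm_smul, Real.norm_of_nonneg (h0 s)]
        by_cases hs : φ s = 0
        · simp [hs]
        · exact mul_le_mul_of_nonneg_left (hδ s hs) (h0 s)
    _ = δ := by rw [integral_mul_const, h1, one_mul]

end Bumps

/-! ### Multipliers of `C_c(G, A)` -/

section Translate

variable {𝕜 G A : Type*} [RCLike 𝕜] [Group G] [TopologicalSpace G] [IsTopologicalGroup G]
  [T2Space G] [LocallyCompactSpace G] [MeasurableSpace G] [BorelSpace G]
  [NonUnitalNormedRing A] [NormedSpace 𝕜 A] [CompleteSpace A]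
  [IsScalarTower 𝕜 A A] [SMulCommClass 𝕜 A A]
  (μ : Measure G) [μ.IsHaarMeasure] (α : DynSys 𝕜 G A)

variable (𝕜 G) in
/-- `s ↦ a f(s)`. -/
def coefMul (a : A) : C_c(G, A) →ₗ[𝕜] C_c(G, A) where
  toFun f := ⟨⟨fun s => a * f s, by have := f.continuous; fun_prop⟩, f.hasCompactSupport.mul_left⟩
  map_add' f g := by ext s; exact mul_add _ _ _
  map_smul' c f := by ext s; exact mul_smul_comm _ _ _

@[simp] theorem coefMul_apply (a : A) (f : C_c(G, A)) (s : G) :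
    coefMul 𝕜 G a f s = a * f s := rfl

/-- `s ↦ α_r(f(r⁻¹ s))`. -/
def translate (r : G) : C_c(G, A) →ₗ[𝕜] C_c(G, A) where
  toFun f := ⟨⟨fun s => α.act r (f (r⁻¹ * s)), by have := f.continuous; fun_prop⟩,
    (f.hasCompactSupport.comp_homeomorph (Homeomorph.mulLeft r⁻¹)).comp_left
      (g := α.act r) (map_zero _)⟩
  map_add' f g := by ext s; exact map_add (α.act r) _ _
  map_smul' c f := by ext s; exact map_smul (α.act r) _ _

@[simp] theorem translate_apply (r : G) (f : C_c(G, A)) (s : G) :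
    translate α r f s = α.act r (f (r⁻¹ * s)) := rfl

/-- The elementary tensor `s ↦ φ(s) a`. -/
def tens (𝕜 : Type*) [RCLike 𝕜] [NormedSpace 𝕜 A] (φ : C_c(G, ℝ)) (a : A) : C_c(G, A) where
  toFun s := (φ s : 𝕜) • a
  continuous_toFun := by
    have := φ.continuous
    fun_prop
  hasCompactSupport' := φ.hasCompactSupport.mono fun s hs h => hs (by simp [h])

@[simp] theorem tens_apply (φ : C_c(G, ℝ)) (a : A) (s : G) : tens 𝕜 φ a s = (φ s : 𝕜) • a := rfl

variable {α} {X : Type*} [NormedAddCommGroup X] [NormedSpace 𝕜 X] [CompleteSpace X]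

theorem ContCovRep.integrated_coefMul (ρ : ContCovRep α X) (a : A) (f : C_c(G, A)) :
    ρ.integrated μ (coefMul 𝕜 G a f) = ρ.π a * ρ.integrated μ f := by
  ext x
  rw [mul_apply_eq_comp, ρ.integrated_apply μ, ρ.integrated_apply μ]
  refine Eq.trans ?_ (gint_comm (ρ.π a) (ρ.integrable_integrand μ f x))
  simp only [coefMul_apply, map_mul, mul_apply_eq_comp]

/-- Left invariance replaces `s` by `r s`, and covariance then moves `U_r` to the front of the
integrand. -/
theorem ContCovRep.integrated_translate (ρ : ContCovRep α X) (r : G) (f : C_c(G, A)) :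
    ρ.integrated μ (translate α r f) = ρ.U r * ρ.integrated μ f := by
  ext x
  rw [mul_apply_eq_comp, ρ.integrated_apply μ, ρ.integrated_apply μ,
    ← gint_mul_left (μ := μ) r (fun s => ρ.π (translate α r f s) (ρ.U s x))]
  refine Eq.trans ?_ (gint_comm (ρ.U r) (ρ.integrable_integrand μ f x))
  simp only [translate_apply, inv_mul_cancel_left, ρ.U_mul_apply, ρ.cov_apply]

theorem ContCovRep.integrated_tens (ρ : ContCovRep α X) (φ : C_c(G, ℝ)) (a : A) (x : X) :
    ρ.integrated μ (tens 𝕜 φ a) x = gint 𝕜 μ (fun s => (φ s : 𝕜) • ρ.π a (ρ.U s x)) := by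
  rw [ρ.integrated_apply μ]
  simp

/-- The elementary tensors `φ ⊗ a` with `φ` an approximate identity converge strongly to `π(a)` in
the integrated form. -/
theorem ContCovRep.tendsto_integrated_tens (ρ : ContCovRep α X) (a : A) (x : X) :
    Tendsto (fun φ => ρ.integrated μ (tens 𝕜 φ a) x) (bumps μ) (𝓝 (ρ.π a x)) := by
  rw [Metric.tendsto_nhds]
  intro δ hδ
  have hF : Continuous fun s => ρ.π a (ρ.U s x) := (ρ.π a).continuous.comp (ρ.strongCont x)
  have hW : {s | ‖ρ.π a (ρ.U s x) - ρ.π a x‖ < δ / 2} ∈ 𝓝 (1 : G) := by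
    refine (isOpen_lt (by fun_prop) continuous_const).mem_nhds ?_
    simp [hδ]
  filter_upwards [eventually_bumps μ hW] with φ ⟨h0, h1, h2⟩
  rw [dist_eq_norm, ρ.integrated_tens μ]
  refine (norm_gint_bump_sub_le μ h0 h1 hF (δ := δ / 2) fun s hs => ?_).trans_lt (by linarith)
  by_contra h
  exact hs (h2 s fun h' => h h'.le)

end Translate

/-! ### Uniform convergence on compact sets implies convergence in the crossed product -/

section Convergence

variable {𝕜 G A : Type*} [RCLike 𝕜] [Group G] [TopologicalSpace G] [IsTopologicalGroup G]
  [T2Space G] [LocallyCompactSpace G] [MeasurableSpace G] [BorelSpace G]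
  [NonUnitalNormedRing A] [NormedSpace 𝕜 A] [CompleteSpace A]
  [IsScalarTower 𝕜 A A] [SMulCommClass 𝕜 A A]
  (μ : Measure G) [μ.IsHaarMeasure] {α : DynSys 𝕜 G A} (R : UnifBddClass.{w} α)

/-- The bounds on `π` and on `U` over `K` are uniform over the class, so the constant can be the
product of these bounds with `μ(K)`. -/
theorem exists_sigma_le_of_compact {K : Set G} (hK : IsCompact K) :
    ∃ C : ℝ, 0 ≤ C ∧ ∀ (f : C_c(G, A)) (δ : ℝ), (∀ s, s ∉ K → f s = 0) →
      (∀ s ∈ K, ‖f s‖ ≤ δ) → sigma μ R f ≤ C * δ := by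
  obtain ⟨C, ν, hν, hR⟩ := R.bdd
  obtain ⟨M, hM⟩ := hν K hK
  refine ⟨C * M * μ.real K, by positivity, fun f δ h0 hδ => ?_⟩
  have hts : tsupport f ⊆ K := closure_minimal
    (fun s hs => by by_contra h; exact hs (h0 s h)) hK.isClosed
  have hint : ∫ s, ‖f s‖ ∂μ ≤ δ * μ.real K := by
    rw [← setIntegral_eq_integral_of_forall_compl_eq_zero (s := K)
      (fun s hs => by rw [h0 s hs, norm_zero])]
    exact (le_abs_self _).trans (norm_setIntegral_le_of_norm_le_const (f := fun s => ‖f s‖)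
      hK.measure_lt_top fun s hs => by simpa using hδ s hs)
  have hint0 : 0 ≤ ∫ s, ‖f s‖ ∂μ := integral_nonneg fun _ => norm_nonneg _
  -- The sign of `δ` is not assumed (`K` may be empty), but `δ μ(K)` dominates an integral of norms.
  have hnn : 0 ≤ C * M * μ.real K * δ := by
    rw [mul_assoc, mul_comm (μ.real K)]
    exact mul_nonneg (by positivity) (hint0.trans hint)
  refine sigma_le μ R hnn fun X ρ hρ => ?_
  obtain ⟨h1, h2⟩ := hR X ρ hρ
  refine ContinuousLinearMap.opNorm_le_bound _ hnn fun x => ?_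
  refine (ρ.norm_gint_integrand_le μ f x h1 C.2 (M := M) fun s hs =>
    (h2 s).trans (NNReal.coe_le_coe.2 (hM ⟨s, hts hs, rfl⟩))).trans ?_
  calc C * M * (∫ s, ‖f s‖ ∂μ) * ‖x‖ ≤ C * M * (δ * μ.real K) * ‖x‖ := by gcongr
    _ = C * M * μ.real K * δ * ‖x‖ := by ring

theorem tendsto_q_of_uniform {ι : Type*} {l : Filter ι} {F : ι → C_c(G, A)} {f : C_c(G, A)}
    {K : Set G} (hK : IsCompact K) (hF : ∀ᶠ i in l, ∀ s, s ∉ K → F i s = 0)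
    (hf : ∀ s, s ∉ K → f s = 0) (h : ∀ δ : ℝ, 0 < δ → ∀ᶠ i in l, ∀ s ∈ K, ‖F i s - f s‖ ≤ δ) :
    Tendsto (fun i => CrossedProduct.q μ R (F i)) l (𝓝 (CrossedProduct.q μ R f)) := by
  obtain ⟨C, hC, hb⟩ := exists_sigma_le_of_compact μ R hK
  rw [Metric.tendsto_nhds]
  intro δ hδ
  -- `C` may vanish, hence the division by `C + 1`.
  filter_upwards [hF, h (δ / (C + 1)) (by positivity)] with i h0 hi
  rw [dist_eq_norm, ← map_sub, CrossedProduct.norm_q]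
  refine (hb (F i - f) (δ / (C + 1)) (fun s hs => ?_) (fun s hs => ?_)).trans_lt ?_
  · change F i s - f s = 0
    rw [h0 s hs, hf s hs, sub_zero]
  · exact hi s hs
  · rw [mul_div_assoc', div_lt_iff₀ (by positivity)]
    nlinarith

open Pointwise in
-- `(r, s) ↦ α_r(f(r⁻¹ s))` is jointly continuous, so currying makes it continuous in `r` for
-- uniform convergence on compact sets. For `r` in a compact neighbourhood `K₀` all supports lie in
-- `K₀ * tsupport f`.
theorem continuous_q_translate (f : C_c(G, A)) :
    Continuous fun r => CrossedProduct.q μ R (translate α r f) := by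
  rw [continuous_iff_continuousAt]
  intro r₀
  obtain ⟨K₀, hK₀, hr₀⟩ := exists_compact_mem_nhds r₀
  have hH : Continuous fun p : G × G => α.act p.1 (f (p.1⁻¹ * p.2)) := by
    have h2 : Continuous (fun p : G × G => (p.1, f (p.1⁻¹ * p.2))) := by
      have := f.continuous
      fun_prop
    exact (joint_continuous α.act_cont).comp h2
  have hK : IsCompact (K₀ * tsupport f) := hK₀.mul f.hasCompactSupport.isCompact
  have h0 : ∀ r ∈ K₀, ∀ s, s ∉ K₀ * tsupport f → translate α r f s = 0 := by
    intro r hr s hs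
    have : f (r⁻¹ * s) = 0 := image_eq_zero_of_notMem_tsupport fun h =>
      hs ⟨r, hr, r⁻¹ * s, h, by simp⟩
    simp [this]
  refine tendsto_q_of_uniform μ R hK ?_ (h0 r₀ (mem_of_mem_nhds hr₀)) ?_
  · filter_upwards [hr₀] with r hr using h0 r hr
  · intro δ hδ
    have hcurry := (ContinuousMap.curry ⟨_, hH⟩).continuous.tendsto r₀
    rw [ContinuousMap.tendsto_iff_forall_isCompact_tendstoUniformlyOn] at hcurry
    filter_upwards [Metric.tendstoUniformlyOn_iff.1 (hcurry _ hK) δ hδ] with r hr s hs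
    have := hr s hs
    rw [dist_comm, dist_eq_norm] at this
    exact this.le

/-- Pointwise convergence `u * f(s) → f(s)` becomes uniform on the support of `f` by compactness:
the bound on `u` controls the error on a neighbourhood of each point. -/
theorem tendsto_q_coefMul {l : Filter A} {M : ℝ} (hM : ∀ᶠ u in l, ‖u‖ ≤ M)
    (hl : ∀ a : A, Tendsto (fun u => u * a) l (𝓝 a)) (f : C_c(G, A)) :
    Tendsto (fun u => CrossedProduct.q μ R (coefMul 𝕜 G u f)) l (𝓝 (CrossedProduct.q μ R f)) := by
  have h0 : ∀ s, s ∉ tsupport f → f s = 0 := fun s hs => image_eq_zero_of_notMem_tsupport hs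
  refine tendsto_q_of_uniform μ R f.hasCompactSupport.isCompact
    (.of_forall fun u s hs => by simp [h0 s hs]) h0 fun δ hδ => ?_
  refine f.hasCompactSupport.isCompact.induction_on
    (p := fun S => ∀ᶠ u in l, ∀ s ∈ S, ‖coefMul 𝕜 G u f s - f s‖ ≤ δ) (by simp)
    (fun S T hST hT => hT.mono fun u hu s hs => hu s (hST hs)) ?_ ?_
  · intro S T hS hT
    filter_upwards [hS, hT] with u h1 h2 s hs using hs.elim (h1 s) (h2 s)
  · intro s _
    -- The radius is chosen so that the two terms containing `f t - f s`, one of them multiplied by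
    -- `u`, add up to at most `δ / 2`.
    have hN : {t | ‖f t - f s‖ < δ / (2 * (|M| + 1))} ∈ 𝓝 s := by
      have := f.continuous
      refine (isOpen_lt (by fun_prop) continuous_const).mem_nhds ?_
      rw [mem_ofPred_eq, sub_self, norm_zero]
      positivity
    refine ⟨_, mem_nhdsWithin_of_mem_nhds hN, ?_⟩
    filter_upwards [hM, Metric.tendsto_nhds.1 (hl (f s)) (δ / 2) (by positivity)] with u hu hus t ht
    rw [dist_eq_norm] at hus
    have e : coefMul 𝕜 G u f t - f t = u * (f t - f s) + (u * f s - f s) - (f t - f s) := by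
      rw [coefMul_apply, mul_sub]
      abel
    have h1 : ‖u * (f t - f s)‖ ≤ |M| * (δ / (2 * (|M| + 1))) := by
      refine (norm_mul_le _ _).trans ?_
      gcongr
      exact hu.trans (le_abs_self M)
    have h2 : |M| * (δ / (2 * (|M| + 1))) + δ / (2 * (|M| + 1)) = δ / 2 := by field_simp
    have h3 : ‖f t - f s‖ < δ / (2 * (|M| + 1)) := ht
    rw [e]
    have h4 := norm_sub_le (u * (f t - f s) + (u * f s - f s)) (f t - f s)
    have h5 := norm_add_le (u * (f t - f s)) (u * f s - f s)
    linarith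

end Convergence


/-- The left multiplications by `e i` are eventually bounded operators with a common bound, so their
strong convergence may be tested on a dense set. -/
theorem hasBddLeftApproxId_of_dense (𝕜 : Type*) [RCLike 𝕜] {B : Type*} [NonUnitalNormedRing B]
    [NormedSpace 𝕜 B] [IsScalarTower 𝕜 B B] [SMulCommClass 𝕜 B B] {ι : Type*} {l : Filter ι}
    [l.NeBot] {e : ι → B} {M : ℝ} (hM : ∀ᶠ i in l, ‖e i‖ ≤ M) {D : Set B} (hD : Dense D)
    (h : ∀ d ∈ D, Tendsto (fun i => e i * d) l (𝓝 d)) : HasBddLeftApproxId B M := by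
  refine ⟨l.map e, inferInstance, hM, fun b => tendsto_map'_iff.2 ?_⟩
  refine tendsto_of_dense_span (S := fun i => ContinuousLinearMap.mul 𝕜 B (e i))
    (S₀ := ContinuousLinearMap.id 𝕜 B) (M := M) ?_ (hD.mono Submodule.subset_span) h b
  filter_upwards [hM] with i hi using (ContinuousLinearMap.opNorm_mul_apply_le 𝕜 B _).trans hi

section CrossedProduct

variable {𝕜 G A : Type*} [RCLike 𝕜] [Group G] [TopologicalSpace G] [IsTopologicalGroup G]
  [T2Space G] [LocallyCompactSpace G] [MeasurableSpace G] [BorelSpace G]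
  [NonUnitalNormedRing A] [NormedSpace 𝕜 A] [CompleteSpace A]
  [IsScalarTower 𝕜 A A] [SMulCommClass 𝕜 A A]
  (μ : Measure G) [μ.IsHaarMeasure] {α : DynSys 𝕜 G A} {R : UnifBddClass.{w} α} {ν : G → ℝ≥0}

open CrossedProduct

/-- All members `(π, U)` of the class are non-degenerate, with `π` contractive and
`‖U_r‖ ≤ ν(r)`. -/
def UnifBddClass.BoundedBy (R : UnifBddClass.{w} α) (ν : G → ℝ≥0) : Prop :=
  ∀ X : BanachSp.{w} 𝕜, R.mem X ⊆ boundedReps α ν X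

/-! ### Left multipliers of the crossed product -/

theorem ContCovRep.integrated_sub {X : Type*} [NormedAddCommGroup X] [NormedSpace 𝕜 X]
    [CompleteSpace X] (ρ : ContCovRep α X) (f g : C_c(G, A)) :
    ρ.integrated μ (f - g) = ρ.integrated μ f - ρ.integrated μ g :=
  map_sub (ρ.integratedLin μ) f g

variable {μ} in
theorem clm_ext_q {E : Type*} [NormedAddCommGroup E] [NormedSpace 𝕜 E]
    {S S' : CrossedProduct μ R →L[𝕜] E} (h : ∀ f, S (q μ R f) = S' (q μ R f)) : S = S' := by
  ext c
  induction c using CrossedProduct.induction with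
  | hc => exact isClosed_eq S.continuous S'.continuous
  | h f => exact h f

/-- The norm is a supremum over the class, so identities in the crossed product can be checked on
operators, in each member separately. -/
theorem q_congr {f g : C_c(G, A)}
    (h : ∀ (X : BanachSp.{w} 𝕜), ∀ ρ ∈ R.mem X, ρ.integrated μ f = ρ.integrated μ g) :
    q μ R f = q μ R g := by
  rw [← sub_eq_zero, ← map_sub, ← norm_eq_zero, norm_q]
  refine le_antisymm (sigma_le μ R le_rfl fun X ρ hρ => ?_) (sigma_nonneg μ R _)
  rw [ρ.integrated_sub μ, h X ρ hρ, sub_self, norm_zero]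

/-- In each member of the class `coefMul` turns into left multiplication by the operator `π(a)`, of
norm at most `‖a‖`; the bound survives the supremum. -/
theorem norm_q_coefMul_le (hR : R.BoundedBy ν) (a : A)
    (f : C_c(G, A)) : ‖(q μ R ∘ₗ coefMul 𝕜 G a) f‖ ≤ ‖a‖ * ‖q μ R f‖ := by
  rw [LinearMap.comp_apply, norm_q, norm_q]
  refine sigma_le μ R (mul_nonneg (norm_nonneg a) (sigma_nonneg μ R f)) fun X ρ hρ => ?_
  rw [ρ.integrated_coefMul μ]
  exact (norm_mul_le _ _).trans (mul_le_mul ((hR X hρ).2.1 a) (norm_integrated_le_sigma μ R hρ f)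
    (norm_nonneg _) (norm_nonneg _))

theorem norm_q_translate_le (hR : R.BoundedBy ν) (r : G)
    (f : C_c(G, A)) : ‖(q μ R ∘ₗ translate α r) f‖ ≤ ν r * ‖q μ R f‖ := by
  rw [LinearMap.comp_apply, norm_q, norm_q]
  refine sigma_le μ R (mul_nonneg (ν r).2 (sigma_nonneg μ R f)) fun X ρ hρ => ?_
  rw [ρ.integrated_translate μ]
  exact (norm_mul_le _ _).trans (mul_le_mul ((hR X hρ).2.2 r) (norm_integrated_le_sigma μ R hρ f)
    (norm_nonneg _) (ν r).2)

variable (R) in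
/-- The left multiplier `q(f) ↦ q(a f)`. -/
def algMult (a : A) : CrossedProduct μ R →L[𝕜] CrossedProduct μ R :=
  (q μ R ∘ₗ coefMul 𝕜 G a).extendOfNorm (q μ R)

variable (R) in
/-- The left multiplier `q(f) ↦ q(α_r(f(r⁻¹ ·)))`. -/
def groupMult (r : G) : CrossedProduct μ R →L[𝕜] CrossedProduct μ R :=
  (q μ R ∘ₗ translate α r).extendOfNorm (q μ R)

section

theorem algMult_q (hR : R.BoundedBy ν) (a : A) (f : C_c(G, A)) :
    algMult μ R a (q μ R f) = q μ R (coefMul 𝕜 G a f) :=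
  LinearMap.extendOfNorm_eq (denseRange_q μ R) ⟨_, norm_q_coefMul_le μ hR a⟩ f

theorem groupMult_q (hR : R.BoundedBy ν) (r : G) (f : C_c(G, A)) :
    groupMult μ R r (q μ R f) = q μ R (translate α r f) :=
  LinearMap.extendOfNorm_eq (denseRange_q μ R) ⟨_, norm_q_translate_le μ hR r⟩ f

theorem norm_algMult_le (hR : R.BoundedBy ν) (a : A) : ‖algMult μ R a‖ ≤ ‖a‖ :=
  LinearMap.opNorm_extendOfNorm_le (denseRange_q μ R) (norm_nonneg a) (norm_q_coefMul_le μ hR a)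

theorem norm_groupMult_le (hR : R.BoundedBy ν) (r : G) : ‖groupMult μ R r‖ ≤ ν r :=
  LinearMap.opNorm_extendOfNorm_le (denseRange_q μ R) (ν r).2 (norm_q_translate_le μ hR r)

/-- On the images of `C_c(G, A)` this is associativity of operator composition in each member of the
class. It is the property of left multipliers that `multExt_apply` requires. -/
theorem algMult_mul (hR : R.BoundedBy ν) (a : A) (b c : CrossedProduct μ R) :
    algMult μ R a (b * c) = algMult μ R a b * c := by
  simp only [mul_def]
  induction b using CrossedProduct.induction with
  | hc => exact isClosed_eq (by fun_prop) (by fun_prop)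
  | h f =>
  induction c using CrossedProduct.induction with
  | hc => exact isClosed_eq (by fun_prop) (by fun_prop)
  | h g =>
  rw [← mul_def, ← mul_def, q_mul, algMult_q μ hR, algMult_q μ hR, q_mul]
  refine q_congr μ fun X ρ _ => ?_
  rw [ρ.integrated_coefMul μ, ρ.integrated_conv μ, ρ.integrated_conv μ, ρ.integrated_coefMul μ,
    mul_assoc]

theorem groupMult_mul (hR : R.BoundedBy ν) (r : G) (b c : CrossedProduct μ R) :
    groupMult μ R r (b * c) = groupMult μ R r b * c := by
  simp only [mul_def]
  induction b using CrossedProduct.induction with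
  | hc => exact isClosed_eq (by fun_prop) (by fun_prop)
  | h f =>
  induction c using CrossedProduct.induction with
  | hc => exact isClosed_eq (by fun_prop) (by fun_prop)
  | h g =>
  rw [← mul_def, ← mul_def, q_mul, groupMult_q μ hR, groupMult_q μ hR, q_mul]
  refine q_congr μ fun X ρ _ => ?_
  rw [ρ.integrated_translate μ, ρ.integrated_conv μ, ρ.integrated_conv μ,
    ρ.integrated_translate μ, mul_assoc]

theorem algMult_add (hR : R.BoundedBy ν) (a b : A) :
    algMult μ R (a + b) = algMult μ R a + algMult μ R b := by
  refine clm_ext_q fun f => ?_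
  rw [add_apply, algMult_q μ hR, algMult_q μ hR, algMult_q μ hR, ← map_add]
  congr 1
  ext s
  exact add_mul a b (f s)

theorem algMult_smul (hR : R.BoundedBy ν) (k : 𝕜) (a : A) :
    algMult μ R (k • a) = k • algMult μ R a := by
  refine clm_ext_q fun f => ?_
  rw [smul_apply, algMult_q μ hR, algMult_q μ hR, ← map_smul]
  congr 1
  ext s
  exact smul_mul_assoc k a (f s)

theorem algMult_mul_left (hR : R.BoundedBy ν) (a b : A) :
    algMult μ R (a * b) = algMult μ R a ∘L algMult μ R b := by
  refine clm_ext_q fun f => ?_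
  rw [ContinuousLinearMap.comp_apply, algMult_q μ hR, algMult_q μ hR, algMult_q μ hR]
  congr 1
  ext s
  exact mul_assoc a b (f s)

theorem groupMult_one (hR : R.BoundedBy ν) : groupMult μ R 1 = ContinuousLinearMap.id 𝕜 _ := by
  refine clm_ext_q fun f => ?_
  rw [groupMult_q μ hR, ContinuousLinearMap.id_apply]
  congr 1
  ext s
  simp

theorem groupMult_mul_left (hR : R.BoundedBy ν) (r s : G) :
    groupMult μ R (r * s) = groupMult μ R r ∘L groupMult μ R s := by
  refine clm_ext_q fun f => ?_
  rw [ContinuousLinearMap.comp_apply, groupMult_q μ hR, groupMult_q μ hR, groupMult_q μ hR]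
  congr 1
  ext t
  simp [mul_assoc]

/-- The covariance relation on the level of multipliers, which rests on the multiplicativity of
`α_r`. -/
theorem algMult_act (hR : R.BoundedBy ν) (a : A) (r : G) :
    algMult μ R (α.act r a) ∘L groupMult μ R r = groupMult μ R r ∘L algMult μ R a := by
  refine clm_ext_q fun f => ?_
  rw [ContinuousLinearMap.comp_apply, ContinuousLinearMap.comp_apply, groupMult_q μ hR,
    algMult_q μ hR, algMult_q μ hR, groupMult_q μ hR]
  congr 1
  ext t
  simp [α.act_mul]

/-- `a ↦ algMult a` as a bounded operator. -/
def algMultL (hR : R.BoundedBy ν) : A →L[𝕜] (CrossedProduct μ R →L[𝕜] CrossedProduct μ R) :=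
  LinearMap.mkContinuous
    { toFun := fun a => algMult μ R a
      map_add' := algMult_add μ hR
      map_smul' := algMult_smul μ hR } 1 (fun a => by simpa using norm_algMult_le μ hR a)

theorem algMultL_apply (hR : R.BoundedBy ν) (a : A) : algMultL μ hR a = algMult μ R a := rfl

/-! ### The crossed product has a bounded left approximate identity -/

/-- In each representation `(φ ⊗ u) * g` acts as the `φ`-average over `s` of the integrated forms of
`u · (s · g)`, so it is as close to `g` as the averaged elements are. -/
theorem sigma_conv_tens_sub_le {φ : C_c(G, ℝ)} (h0 : ∀ s, 0 ≤ φ s) (h1 : ∫ s, φ s ∂μ = 1)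
    {u : A} {g : C_c(G, A)} {δ : ℝ} (hδ0 : 0 ≤ δ)
    (hδ : ∀ s, φ s ≠ 0 → sigma μ R (coefMul 𝕜 G u (translate α s g) - g) ≤ δ) :
    sigma μ R (conv μ α (tens 𝕜 φ u) g - g) ≤ δ := by
  refine sigma_le μ R hδ0 fun X ρ hρ => ContinuousLinearMap.opNorm_le_bound _ hδ0 fun x => ?_
  rw [ρ.integrated_sub μ, ρ.integrated_conv μ, sub_apply, mul_apply_eq_comp, ρ.integrated_tens μ]
  refine norm_gint_bump_sub_le μ h0 h1 ((ρ.π u).continuous.comp (ρ.strongCont _)) fun s hs => ?_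
  have e : ρ.π u (ρ.U s (ρ.integrated μ g x)) - ρ.integrated μ g x =
      ρ.integrated μ (coefMul 𝕜 G u (translate α s g) - g) x := by
    rw [ρ.integrated_sub μ, ρ.integrated_coefMul μ, ρ.integrated_translate μ]
    rfl
  rw [Function.comp_apply, e]
  exact ContinuousLinearMap.le_of_opNorm_le _
    ((norm_integrated_le_sigma μ R hρ _).trans (hδ s hs)) x

/-- `φ ⊗ u` acts as the `φ`-average of `π(u) U_s`; only the values of `ν` where `φ` is non-zero
matter, so concentrating `φ` at the identity improves the bound. -/
theorem sigma_tens_le (hR : R.BoundedBy ν) {φ : C_c(G, ℝ)} (h0 : ∀ s, 0 ≤ φ s)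
    (h1 : ∫ s, φ s ∂μ = 1) (u : A) {M : ℝ} (hM0 : 0 ≤ M) (hM : ∀ s, φ s ≠ 0 → ν s ≤ M) :
    sigma μ R (tens 𝕜 φ u) ≤ ‖u‖ * M := by
  have hnn : 0 ≤ ‖u‖ * M := mul_nonneg (norm_nonneg u) hM0
  refine sigma_le μ R hnn fun X ρ hρ => ContinuousLinearMap.opNorm_le_bound _ hnn fun x => ?_
  rw [ρ.integrated_tens μ, ← sub_zero (gint _ _ _)]
  refine norm_gint_bump_sub_le μ h0 h1 ((ρ.π u).continuous.comp (ρ.strongCont x)) fun s hs => ?_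
  rw [sub_zero, mul_assoc]
  refine (ContinuousLinearMap.le_of_opNorm_le _ ((hR X hρ).2.1 u) _).trans ?_
  gcongr
  exact ContinuousLinearMap.le_of_opNorm_le _ (((hR X hρ).2.2 s).trans (hM s hs)) x

/-- Split `u · (s · q(g)) - q(g)` as `u · (s · q(g) - q(g)) + (u · q(g) - q(g))`. The first term is
small for `s` near the identity, uniformly over `‖u‖ ≤ M`, and the second does not involve `s`. The
two limits can therefore be taken independently, along the product filter. -/
theorem tendsto_approxId_q (hR : R.BoundedBy ν) {l : Filter A} {M : ℝ}
    (hM : ∀ᶠ u in l, ‖u‖ ≤ M)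
    (hl : ∀ a : A, Tendsto (fun u => u * a) l (𝓝 a)) (g : C_c(G, A)) :
    Tendsto (fun p : C_c(G, ℝ) × A => q μ R (tens 𝕜 p.1 p.2) * q μ R g) (bumps μ ×ˢ l)
      (𝓝 (q μ R g)) := by
  rw [Metric.tendsto_nhds]
  intro δ hδ
  have hW : {s | ‖q μ R (translate α s g) - q μ R g‖ < δ / (4 * (|M| + 1))} ∈ 𝓝 (1 : G) := by
    have := continuous_q_translate μ R g
    refine (isOpen_lt (by fun_prop) continuous_const).mem_nhds ?_
    have e : translate α 1 g = g := by ext s; simp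
    rw [mem_ofPred_eq, e, sub_self, norm_zero]
    positivity
  have hu := Metric.tendsto_nhds.1 (tendsto_q_coefMul μ R hM hl g) (δ / 4) (by positivity)
  filter_upwards [(eventually_bumps μ hW).prod_mk (hM.and hu)] with p ⟨⟨h0, h1, h2⟩, hpM, hp⟩
  rw [dist_eq_norm] at hp ⊢
  rw [q_mul, ← map_sub, norm_q]
  refine (sigma_conv_tens_sub_le μ h0 h1 (δ := δ / 2) (by positivity) fun s hs => ?_).trans_lt
    (by linarith)
  have hsW : ‖q μ R (translate α s g) - q μ R g‖ < δ / (4 * (|M| + 1)) := by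
    by_contra h
    exact hs (h2 s h)
  rw [← norm_q, map_sub, ← algMult_q μ hR]
  have e : algMult μ R p.2 (q μ R (translate α s g)) - q μ R g =
      algMult μ R p.2 (q μ R (translate α s g) - q μ R g) +
        (q μ R (coefMul 𝕜 G p.2 g) - q μ R g) := by
    rw [map_sub, algMult_q μ hR _ g]
    abel
  have h3 : ‖algMult μ R p.2 (q μ R (translate α s g) - q μ R g)‖ ≤ δ / 4 := by
    calc _ ≤ (|M| + 1) * (δ / (4 * (|M| + 1))) := by
          refine (ContinuousLinearMap.le_opNorm _ _).trans ?_
          gcongr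
          refine (norm_algMult_le μ hR _).trans (hpM.trans ?_)
          linarith [le_abs_self M]
      _ = δ / 4 := by field_simp
  rw [e]
  exact (norm_add_le _ _).trans (by linarith)

theorem hasBddLeftApproxId_crossedProduct (hR : R.BoundedBy ν)
    (hA : ∀ ε : ℝ, 0 < ε → HasBddLeftApproxId A (1 + ε))
    (hν : ∀ ε : ℝ, 0 < ε → ∀ᶠ r in 𝓝 (1 : G), (ν r : ℝ) ≤ 1 + ε) (ε : ℝ) (hε : 0 < ε) :
    HasBddLeftApproxId (CrossedProduct μ R) (1 + ε) := by
  obtain ⟨η, hη, hηε⟩ : ∃ η : ℝ, 0 < η ∧ (1 + η) * (1 + η) ≤ 1 + ε := by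
    -- As `η ≤ 1`, one has `(1 + η)² ≤ 1 + 3η ≤ 1 + ε`. One factor will bound `‖u‖`, the other `ν`
    -- near the identity.
    refine ⟨min 1 (ε / 3), by positivity, ?_⟩
    have h1 : min 1 (ε / 3) ≤ 1 := min_le_left _ _
    have h2 : min 1 (ε / 3) ≤ ε / 3 := min_le_right _ _
    have h3 : 0 < min 1 (ε / 3) := by positivity
    nlinarith
  obtain ⟨l, hne, hM, hl⟩ := hA η hη
  have hb : ∀ᶠ p in bumps μ ×ˢ l, ‖q μ R (tens 𝕜 p.1 p.2)‖ ≤ 1 + ε := by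
    filter_upwards [(eventually_bumps μ (hν η hη)).prod_mk hM] with p ⟨⟨h0, h1, h2⟩, hpM⟩
    rw [norm_q]
    refine (sigma_tens_le μ hR h0 h1 p.2 (M := 1 + η) (by positivity) fun s hs => ?_).trans ?_
    · by_contra h
      exact hs (h2 s h)
    · exact (mul_le_mul_of_nonneg_right hpM (by positivity)).trans hηε
  refine hasBddLeftApproxId_of_dense 𝕜 hb (denseRange_q μ R) ?_
  rintro _ ⟨g, rfl⟩
  exact tendsto_approxId_q μ hR hM hl g

end

/-! ### The integrated form on the crossed product -/

section IntegratedRep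

variable {X : BanachSp.{w} 𝕜}

theorem repContractive_integratedRep (ρ : R.mem X) : RepContractive (integratedRep μ ρ) :=
  fun c => (LinearMap.norm_extendOfNorm_apply_le (denseRange_q μ R) 1
    (norm_integratedLin_le μ ρ.2) c).trans_eq (one_mul _)

/-- Each `π(a) x` is the limit of the integrated forms of `φ ⊗ a`, applied to `x`, as `φ`
concentrates at the identity. -/
theorem repNonDegenerate_integratedRep (ρ : R.mem X) (hρ : RepNonDegenerate ρ.1.π) :
    RepNonDegenerate (integratedRep μ ρ) := by
  refine RepNonDegenerate.of_mem_closure hρ ?_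
  rintro _ ⟨a, x, rfl⟩
  refine mem_closure_of_tendsto (ρ.1.tendsto_integrated_tens μ a x) (.of_forall fun φ => ?_)
  exact ⟨q μ R (tens 𝕜 φ a), x, by rw [integratedRep_q]⟩

theorem continuous_integratedRep (ρ : R.mem X) : Continuous (integratedRep μ ρ) :=
  (repL _ (repContractive_integratedRep μ ρ)).continuous

/-- This and its analogue for `groupMult` determine the pair from its integrated form, whose ranges
span a dense subspace. -/
theorem integratedRep_algMult (hR : R.BoundedBy ν) (ρ : R.mem X) (a : A)
    (c : CrossedProduct μ R) :
    integratedRep μ ρ (algMult μ R a c) = ρ.1.π a * integratedRep μ ρ c := by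
  have := continuous_integratedRep μ ρ
  induction c using CrossedProduct.induction with
  | hc => exact isClosed_eq (by fun_prop) (by fun_prop)
  | h f => rw [algMult_q μ hR, integratedRep_q, integratedRep_q, ρ.1.integrated_coefMul μ]

theorem integratedRep_groupMult (hR : R.BoundedBy ν) (ρ : R.mem X) (r : G)
    (c : CrossedProduct μ R) :
    integratedRep μ ρ (groupMult μ R r c) = ρ.1.U r * integratedRep μ ρ c := by
  have := continuous_integratedRep μ ρ
  induction c using CrossedProduct.induction with
  | hc => exact isClosed_eq (by fun_prop) (by fun_prop)
  | h f => rw [groupMult_q μ hR, integratedRep_q, integratedRep_q, ρ.1.integrated_translate μ]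

/-- The integrated forms separate the points of the crossed product. -/
theorem eq_zero_of_integratedRep {c : CrossedProduct μ R}
    (h : ∀ (X : BanachSp.{w} 𝕜) (ρ : R.mem X), integratedRep μ ρ c = 0) : c = 0 := by
  rw [← norm_le_zero_iff]
  refine le_of_forall_pos_le_add fun δ hδ => ?_
  -- Since `c` acts as zero in every member of the class, `f` acts as the negative of `c - q(f)`;
  -- hence the supremum defining `‖q(f)‖` is at most the distance from `c` to `q(f)`.
  obtain ⟨f, hf⟩ := (denseRange_q μ R).exists_dist_lt c (half_pos hδ)
  rw [dist_eq_norm] at hf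
  have h1 : ‖q μ R f‖ ≤ δ / 2 := by
    rw [norm_q]
    refine sigma_le μ R (by positivity) fun X ρ hρ => ?_
    have e : ρ.integrated μ f = - integratedRep μ ⟨ρ, hρ⟩ (c - q μ R f) := by
      rw [map_sub, h X, integratedRep_q, zero_sub, neg_neg]
    rw [e, norm_neg]
    exact (repContractive_integratedRep μ ⟨ρ, hρ⟩ _).trans hf.le
  have h2 : c = (c - q μ R f) + q μ R f := by abel
  rw [h2]
  exact (norm_add_le _ _).trans (by linarith)

theorem continuous_algMult_translate (hR : R.BoundedBy ν) (f g : C_c(G, A)) :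
    Continuous fun s => algMult μ R (f s) (q μ R (translate α s g)) :=
  ((algMultL μ hR).continuous.comp f.continuous).clm_apply (continuous_q_translate μ R g)

theorem integrable_algMult_translate (hR : R.BoundedBy ν) (f g : C_c(G, A)) :
    Integrable (fun s => algMult μ R (f s) (q μ R (translate α s g))) μ := by
  refine (continuous_algMult_translate μ hR f g).integrable_of_hasCompactSupport
    (f.hasCompactSupport.mono fun s hs h => hs ?_)
  change algMult μ R (f s) _ = 0
  rw [h, ← algMultL_apply μ hR, map_zero, zero_apply]

/-- `q(f * g) = ∫ f(s) · (s · q(g)) ds`. -/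
theorem q_conv_eq_gint (hR : R.BoundedBy ν) (f g : C_c(G, A)) :
    q μ R (conv μ α f g) =
      gint 𝕜 μ (fun s => algMult μ R (f s) (q μ R (translate α s g))) := by
  rw [← sub_eq_zero]
  -- In each member of the class, evaluated at `x`, both sides become the integral of `π(f(s)) U_s`
  -- applied to the image of `x` under the integrated form of `g`.
  refine eq_zero_of_integratedRep μ fun X ρ => ?_
  ext x
  have h := gint_comm ((repL _ (repContractive_integratedRep μ ρ)).flip x)
    (integrable_algMult_translate μ hR f g)
  simp only [ContinuousLinearMap.flip_apply, repL_apply] at h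
  rw [map_sub, sub_apply, ← h, integratedRep_q, ρ.1.integrated_conv μ, mul_apply_eq_comp,
    ρ.1.integrated_apply μ, zero_apply, sub_eq_zero]
  congr 1
  funext s
  rw [integratedRep_algMult μ hR, integratedRep_q, ρ.1.integrated_translate μ]
  rfl

end IntegratedRep

/-! ### Disintegration -/

section Disintegration

variable {X : Type*} [NormedAddCommGroup X] [NormedSpace 𝕜 X] [CompleteSpace X]

/-- The covariant representation whose integrated form is a given non-degenerate contractive
representation of the crossed product. -/
def disintegrate (hR : R.BoundedBy ν)
    (hν : ∀ K : Set G, IsCompact K → BddAbove (ν '' K))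
    (hB : ∀ ε : ℝ, 0 < ε → HasBddLeftApproxId (CrossedProduct μ R) (1 + ε))
    (T : CrossedProduct μ R →ₙₐ[𝕜] (X →L[𝕜] X)) (hT : RepNonDegenerate T)
    (hc : RepContractive T) : ContCovRep α X where
  π :=
    { toFun := fun a => multExt T hc (algMult μ R a)
      map_smul' := fun k a => hT.clm_ext fun b x => by
        rw [multExt_apply hT hc hB (algMult_mul μ hR _), algMult_smul μ hR, smul_apply, map_smul,
          MonoidHom.id_apply, smul_apply, smul_apply,
          multExt_apply hT hc hB (algMult_mul μ hR _)]
      map_zero' := hT.clm_ext fun b x => by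
        rw [multExt_apply hT hc hB (algMult_mul μ hR _), ← algMultL_apply μ hR, map_zero,
          zero_apply, map_zero, zero_apply, zero_apply]
      map_add' := fun a a' => hT.clm_ext fun b x => by
        rw [multExt_apply hT hc hB (algMult_mul μ hR _), algMult_add μ hR, add_apply, map_add,
          add_apply, add_apply, multExt_apply hT hc hB (algMult_mul μ hR _),
          multExt_apply hT hc hB (algMult_mul μ hR _)]
      map_mul' := fun a a' => hT.clm_ext fun b x => by
        rw [multExt_apply hT hc hB (algMult_mul μ hR _), algMult_mul_left μ hR, mul_apply_eq_comp,
          multExt_apply hT hc hB (algMult_mul μ hR _),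
          multExt_apply hT hc hB (algMult_mul μ hR _)]
        rfl }
  U :=
    { toFun := fun r => multExt T hc (groupMult μ R r)
      map_one' := hT.clm_ext fun b x => by
        rw [multExt_apply hT hc hB (groupMult_mul μ hR _), groupMult_one μ hR]
        rfl
      map_mul' := fun r s => hT.clm_ext fun b x => by
        rw [multExt_apply hT hc hB (groupMult_mul μ hR _), groupMult_mul_left μ hR,
          mul_apply_eq_comp, multExt_apply hT hc hB (groupMult_mul μ hR _),
          multExt_apply hT hc hB (groupMult_mul μ hR _)]
        rfl }
  covariant a s := hT.clm_ext fun b x => by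
    -- Covariance of the multipliers, evaluated at `s⁻¹ · b`.
    have h : algMult μ R (α.act s a) b =
        groupMult μ R s (algMult μ R a (groupMult μ R s⁻¹ b)) := by
      have h1 := DFunLike.congr_fun (algMult_act μ hR a s) (groupMult μ R s⁻¹ b)
      have h2 := DFunLike.congr_fun (groupMult_mul_left μ hR s s⁻¹) b
      rw [mul_inv_cancel, groupMult_one μ hR, ContinuousLinearMap.comp_apply,
        ContinuousLinearMap.id_apply] at h2
      rw [ContinuousLinearMap.comp_apply, ContinuousLinearMap.comp_apply, ← h2] at h1
      exact h1
    change multExt T hc (algMult μ R (α.act s a)) (T b x) = multExt T hc (groupMult μ R s)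
      (multExt T hc (algMult μ R a) (multExt T hc (groupMult μ R s⁻¹) (T b x)))
    rw [multExt_apply hT hc hB (algMult_mul μ hR _), multExt_apply hT hc hB (groupMult_mul μ hR _),
      multExt_apply hT hc hB (algMult_mul μ hR _), multExt_apply hT hc hB (groupMult_mul μ hR _), h]
  bounded := ⟨1, fun a => by
    rw [one_mul]
    exact (norm_multExt_le hT hc hB (algMult_mul μ hR a)).trans (norm_algMult_le μ hR a)⟩
  strongCont x := by
    rw [continuous_iff_continuousAt]
    intro r₀
    obtain ⟨K, hK, hr₀⟩ := exists_compact_mem_nhds r₀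
    obtain ⟨M, hM⟩ := hν K hK
    -- Near `r₀` the operators are bounded by a bound of `ν` on `K`. Density is used twice: first to
    -- reduce to vectors `T b y`, then to reduce `b` to the image of `C_c(G, A)`.
    refine tendsto_of_dense_span (𝕜 := 𝕜) (M := M) (S := fun r => multExt T hc (groupMult μ R r))
      (S₀ := multExt T hc (groupMult μ R r₀))
      (D := {y : X | ∃ (b : CrossedProduct μ R) (x : X), y = T b x}) ?_ hT ?_ x
    · filter_upwards [hr₀] with r hr
      exact ((norm_multExt_le hT hc hB (groupMult_mul μ hR r)).trans
        (norm_groupMult_le μ hR r)).trans (NNReal.coe_le_coe.2 (hM ⟨r, hr, rfl⟩))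
    · rintro _ ⟨b, y, rfl⟩
      simp only [multExt_apply hT hc hB (groupMult_mul μ hR _)]
      have hcont : Continuous fun b => T b y := ((repL T hc).flip y).continuous
      refine (hcont.tendsto _).comp ?_
      refine tendsto_of_dense_span (M := M) (S := fun r => groupMult μ R r) (D := range (q μ R)) ?_
        ((denseRange_q μ R).mono Submodule.subset_span) ?_ b
      · filter_upwards [hr₀] with r hr
        exact (norm_groupMult_le μ hR r).trans (NNReal.coe_le_coe.2 (hM ⟨r, hr, rfl⟩))
      · rintro _ ⟨f, rfl⟩
        simp only [groupMult_q μ hR]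
        exact (continuous_q_translate μ R f).tendsto r₀

variable (hR : R.BoundedBy ν)
    (hν : ∀ K : Set G, IsCompact K → BddAbove (ν '' K))
    (hB : ∀ ε : ℝ, 0 < ε → HasBddLeftApproxId (CrossedProduct μ R) (1 + ε))
    (T : CrossedProduct μ R →ₙₐ[𝕜] (X →L[𝕜] X)) (hT : RepNonDegenerate T)
    (hc : RepContractive T)

theorem disintegrate_π_apply (a : A) (b : CrossedProduct μ R) (x : X) :
    (disintegrate μ hR hν hB T hT hc).π a (T b x) = T (algMult μ R a b) x :=
  multExt_apply hT hc hB (algMult_mul μ hR _) b x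

theorem disintegrate_U_apply (r : G) (b : CrossedProduct μ R) (x : X) :
    (disintegrate μ hR hν hB T hT hc).U r (T b x) = T (groupMult μ R r b) x :=
  multExt_apply hT hc hB (groupMult_mul μ hR _) b x

/-- For non-degeneracy, `T (q f) x` is the limit of `π(u) (T (q f) x)` along an approximate identity
of `A`. Any bound on the latter suffices; `1 + 1` is the case `ε = 1`. -/
theorem disintegrate_mem_boundedReps (hA : HasBddLeftApproxId A (1 + 1)) :
    disintegrate μ hR hν hB T hT hc ∈ boundedReps α ν X := by
  refine ⟨?_, fun a => (norm_multExt_le hT hc hB (algMult_mul μ hR a)).trans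
    (norm_algMult_le μ hR a), fun r => (norm_multExt_le hT hc hB (groupMult_mul μ hR r)).trans
    (norm_groupMult_le μ hR r)⟩
  refine RepNonDegenerate.of_mem_closure hT ?_
  rintro _ ⟨b, x, rfl⟩
  have hcont : Continuous fun b => T b x := ((repL T hc).flip x).continuous
  induction b using CrossedProduct.induction with
  | hc => exact isClosed_closure.preimage hcont
  | h f =>
  obtain ⟨l, hne, hM, hl⟩ := hA
  refine mem_closure_of_tendsto ((hcont.tendsto _).comp (tendsto_q_coefMul μ R hM hl f))
    (.of_forall fun u => ⟨u, T (q μ R f) x, ?_⟩)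
  rw [disintegrate_π_apply μ hR, algMult_q μ hR]
  rfl

/-- Applying `T` to `q(f) q(g) = ∫ f(s) · (s · q(g)) ds` gives `T (q f)` on the vectors `T (q g) x`
as the integral of `π(f(s)) U_s`, and such vectors have dense span. -/
theorem integrated_disintegrate (f : C_c(G, A)) :
    (disintegrate μ hR hν hB T hT hc).integrated μ f = T (q μ R f) := by
  refine hT.clm_ext fun b x => ?_
  set ρ := disintegrate μ hR hν hB T hT hc
  have hcont : Continuous fun b => T b x := ((repL T hc).flip x).continuous
  have hcont' : Continuous fun b => T (q μ R f) (T b x) := (T (q μ R f)).continuous.comp hcont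
  induction b using CrossedProduct.induction with
  | hc => exact isClosed_eq ((ρ.integrated μ f).continuous.comp hcont) hcont'
  | h g =>
  have h := gint_comm ((repL T hc).flip x) (integrable_algMult_translate μ hR f g)
  rw [← q_conv_eq_gint μ hR] at h
  simp only [ContinuousLinearMap.flip_apply, repL_apply] at h
  have e : T (q μ R f) (T (q μ R g) x) = T (q μ R f * q μ R g) x := by
    rw [map_mul, mul_apply_eq_comp]
  rw [e, q_mul, ← h, ρ.integrated_apply μ]
  congr 1
  funext s
  rw [disintegrate_U_apply μ hR, disintegrate_π_apply μ hR, groupMult_q μ hR]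

end Disintegration

/-! ### Invariant subspaces and intertwining operators -/

section Invariants

variable {X Y : BanachSp.{w} 𝕜}

/-- An integral of `Z`-valued functions stays in the closed subspace `Z`: its image in the Banach
space `X / Z` is the integral of zero. -/
theorem RepInvariant.integratedRep {ρ : R.mem X} {Z : Submodule 𝕜 X} (hZ : IsClosed (Z : Set X))
    (h : ρ.1.Invariant Z) : RepInvariant (integratedRep μ ρ) Z := by
  intro c x hx
  have := continuous_integratedRep μ ρ
  induction c using CrossedProduct.induction with
  | hc =>
    exact hZ.preimage (by fun_prop : Continuous fun c => BanachCP.integratedRep μ ρ c x)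
  | h f =>
  haveI : IsClosed (Z : Set X) := hZ
  have e := gint_comm Z.mkQL (ρ.1.integrable_integrand μ f x)
  have e0 : (fun s => Z.mkQL (ρ.1.integrand f x s)) = fun _ => 0 := by
    funext s
    exact (Submodule.Quotient.mk_eq_zero Z).2 (h.1 _ _ (h.2 s x hx))
  rw [e0] at e
  rw [integratedRep_q, ρ.1.integrated_apply μ]
  refine (Submodule.Quotient.mk_eq_zero Z).1 (e.symm.trans ?_)
  simp [gint]

/-- Along an approximate identity `e` of the crossed product, `π(a) x` and `U_r x` are the limits of
the images of `x` under the integrated forms of `a · e` and `r · e`, which lie in `Z`. -/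
theorem invariant_of_integratedRep (hR : R.BoundedBy ν)
    (hB : HasBddLeftApproxId (CrossedProduct μ R) (1 + 1))
    {ρ : R.mem X} {Z : Submodule 𝕜 X} (hZ : IsClosed (Z : Set X))
    (h : RepInvariant (integratedRep μ ρ) Z) : ρ.1.Invariant Z := by
  obtain ⟨l, hne, hM, hl⟩ := hB
  have key : ∀ x, Tendsto (fun e => integratedRep μ ρ e x) l (𝓝 x) :=
    (repNonDegenerate_integratedRep μ ρ (hR X ρ.2).1).tendsto_approxId
      (repContractive_integratedRep μ ρ) hM hl
  constructor
  · intro a x hx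
    refine hZ.mem_of_tendsto (((ρ.1.π a).continuous.tendsto x).comp (key x))
      (.of_forall fun e => ?_)
    have := h (algMult μ R a e) x hx
    rwa [integratedRep_algMult μ hR] at this
  · intro r x hx
    refine hZ.mem_of_tendsto (((ρ.1.U r).continuous.tendsto x).comp (key x))
      (.of_forall fun e => ?_)
    have := h (groupMult μ R r e) x hx
    rwa [integratedRep_groupMult μ hR] at this

theorem RepIntertwines.integratedRep {ρ : R.mem X} {τ : R.mem Y} {Φ : X →L[𝕜] Y}
    (h : ρ.1.Intertwines τ.1 Φ) :
    RepIntertwines (integratedRep μ ρ) (integratedRep μ τ) Φ := by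
  intro c
  have := continuous_integratedRep μ ρ
  have := continuous_integratedRep μ τ
  induction c using CrossedProduct.induction with
  | hc => exact isClosed_eq (by fun_prop) (by fun_prop)
  | h f =>
  rw [integratedRep_q, integratedRep_q]
  ext x
  have e := gint_comm Φ (ρ.1.integrable_integrand μ f x)
  refine Eq.trans ?_ e
  rw [ContinuousLinearMap.comp_apply, τ.1.integrated_apply μ]
  congr 1
  funext s
  have h1 := DFunLike.congr_fun (h.2 s) x
  have h2 := DFunLike.congr_fun (h.1 (f s)) (ρ.1.U s x)
  simp only [ContinuousLinearMap.comp_apply] at h1 h2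
  rw [h1, h2]
  rfl

/-- Intertwining at `a · c` and at `c` together gives the relation for `π(a)` on vectors in the
range of the integrated form of `c`, and these span a dense subspace. The same holds for `U_r` with
`r · c`. -/
theorem intertwines_of_integratedRep (hR : R.BoundedBy ν) {ρ : R.mem X} {τ : R.mem Y}
    {Φ : X →L[𝕜] Y}
    (h : RepIntertwines (integratedRep μ ρ) (integratedRep μ τ) Φ) :
    ρ.1.Intertwines τ.1 Φ := by
  have hn := repNonDegenerate_integratedRep μ ρ (hR X ρ.2).1
  have h' : ∀ c x, Φ (integratedRep μ ρ c x) = integratedRep μ τ c (Φ x) := fun c x =>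
    (DFunLike.congr_fun (h c) x).symm
  constructor
  · refine fun a => hn.clm_ext fun c x => ?_
    have h1 := h' (algMult μ R a c) x
    rw [integratedRep_algMult μ hR, integratedRep_algMult μ hR, mul_apply_eq_comp,
      mul_apply_eq_comp, ← h'] at h1
    exact h1.symm
  · refine fun r => hn.clm_ext fun c x => ?_
    have h1 := h' (groupMult μ R r c) x
    rw [integratedRep_groupMult μ hR, integratedRep_groupMult μ hR, mul_apply_eq_comp,
      mul_apply_eq_comp, ← h'] at h1
    exact h1.symm

end Invariants

theorem ContCovRep.eq_of_intertwines_id {X : Type*} [NormedAddCommGroup X] [NormedSpace 𝕜 X]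
    {ρ τ : ContCovRep α X} (h : ρ.Intertwines τ (ContinuousLinearMap.id 𝕜 X)) : ρ = τ := by
  obtain ⟨h1, h2⟩ := h
  cases ρ
  cases τ
  congr 1
  · ext a x
    exact (DFunLike.congr_fun (h1 a) x).symm
  · ext r x
    exact (DFunLike.congr_fun (h2 r) x).symm

/-! ### Involutive representations -/

section Star

variable [StarRing A] [StarModule 𝕜 A] [ContinuousStar A]

/-- The inner product is extra data, compatible with the given norm by an equation. Substituting
that equation makes the usual Hilbert space results available. -/
theorem continuous_inner_of_eq {X : Type*} [NormedAddCommGroup X] [NormedSpace 𝕜 X]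
    (H : InnerProductSpace 𝕜 X) (hH : H.toNormedSpace = ‹NormedSpace 𝕜 X›) :
    Continuous fun p : X × X => H.inner p.1 p.2 := by
  subst hH
  exact continuous_inner

theorem inner_integrated_of_eq {X : Type*} [NormedAddCommGroup X] [NormedSpace 𝕜 X]
    [CompleteSpace X] (H : InnerProductSpace 𝕜 X) (hH : H.toNormedSpace = ‹NormedSpace 𝕜 X›)
    (ρ : ContCovRep α X)
    (hπ : ∀ (a : A) (x y : X), H.inner (ρ.π a x) y = H.inner x (ρ.π (star a) y))
    (hU : ∀ (r : G) (x y : X), H.inner (ρ.U r x) (ρ.U r y) = H.inner x y)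
    (f : C_c(G, A)) (x y : X) :
    H.inner (ρ.integrated μ f x) y = H.inner x (ρ.integrated μ (BanachCP.invol α f) y) := by
  subst hH
  exact (inner_integrated_invol μ ρ hπ hU f y x).symm

/-- The adjoint relation holds on the image of `C_c(G, A)`, and both of its sides are continuous in
`c`. -/
theorem repInvolutive_integratedRep
    (hRi : ∀ (X : BanachSp.{w} 𝕜), ∀ ρ ∈ R.mem X, ρ.Involutive) {X : BanachSp.{w} 𝕜}
    (ρ : R.mem X) : RepInvolutive (CrossedProduct.invol μ R) (integratedRep μ ρ) := by
  obtain ⟨H, hH, hπ, hU⟩ := hRi X ρ.1 ρ.2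
  refine ⟨H, hH, fun c x y => ?_⟩
  have hi := continuous_inner_of_eq H hH
  have hρ := continuous_integratedRep μ ρ
  have hs : Continuous (CrossedProduct.invol μ R) :=
    ((involLin μ R).extendOfNorm (CrossedProduct.q μ R)).continuous
  induction c using CrossedProduct.induction with
  | hc =>
    have h1 : Continuous fun c => (integratedRep μ ρ c x, y) := by fun_prop
    have h2 : Continuous fun c => (x, integratedRep μ ρ (CrossedProduct.invol μ R c) y) := by
      fun_prop
    exact isClosed_eq (hi.comp h1) (hi.comp h2)
  | h f =>
  rw [CrossedProduct.invol_q μ R hRi, integratedRep_q, integratedRep_q]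
  exact inner_integrated_of_eq μ H hH ρ.1 hπ hU f x y

end Star

end CrossedProduct

/-! ### The bound near the identity, and the main theorem -/

theorem eventually_le_of_iInf_iSup_eq_one {G : Type*} [Group G] [TopologicalSpace G]
    {𝒵 : Set (Set G)} (h𝒵 : (𝓝 (1 : G)).HasBasis (fun V => V ∈ 𝒵) id)
    (h𝒵K : ∃ K : Set G, IsCompact K ∧ ∀ V ∈ 𝒵, V ⊆ K)
    {ν : G → ℝ≥0} (hν : ∀ K : Set G, IsCompact K → BddAbove (ν '' K))
    (hν1 : (⨅ V : 𝒵, ⨆ r : (V : Set G), ν r) = (1 : ℝ≥0)) (ε : ℝ) (hε : 0 < ε) :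
    ∀ᶠ r in 𝓝 (1 : G), (ν r : ℝ) ≤ 1 + ε := by
  obtain ⟨K, hK, hVK⟩ := h𝒵K
  obtain ⟨V₀, hV₀, -⟩ := h𝒵.mem_iff.1 univ_mem
  haveI : Nonempty 𝒵 := ⟨⟨V₀, hV₀⟩⟩
  have hlt : (⨅ V : 𝒵, ⨆ r : (V : Set G), ν r) < 1 + ⟨ε, hε.le⟩ := by
    rw [hν1]
    exact lt_add_of_pos_right _ (NNReal.coe_pos.1 hε)
  obtain ⟨⟨V, hV⟩, hlt⟩ := exists_lt_of_ciInf_lt hlt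
  filter_upwards [h𝒵.mem_of_mem hV] with r hr
  -- An unbounded supremum in `ℝ≥0` would take the default value 0 and bound nothing; here `V` lies
  -- in the compact set `K`, where `ν` is bounded.
  have hb : BddAbove (range fun r : V => ν r) := by
    refine (hν K hK).mono ?_
    rintro _ ⟨s, rfl⟩
    exact ⟨s, hVK V hV s.2, rfl⟩
  have := (le_ciSup hb ⟨r, hr⟩).trans hlt.le
  exact_mod_cast this

end

end BanachCP

open BanachCP
theorem theoremt {𝕜 G A : Type*} [RCLike 𝕜]
    [Group G] [TopologicalSpace G] [IsTopologicalGroup G] [LocallyCompactSpace G] [T2Space G]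
    [MeasurableSpace G] [BorelSpace G] (μ : Measure G) [μ.IsHaarMeasure]
    [NonUnitalNormedRing A] [NormedSpace 𝕜 A] [IsScalarTower 𝕜 A A] [SMulCommClass 𝕜 A A]
    [CompleteSpace A]
    (α : DynSys 𝕜 G A)
    (hA : ∀ ε : ℝ, 0 < ε → HasBddLeftApproxId A (1 + ε))
    (𝒵 : Set (Set G)) (h𝒵 : (𝓝 (1 : G)).HasBasis (fun V => V ∈ 𝒵) id)
    (h𝒵K : ∃ K : Set G, IsCompact K ∧ ∀ V ∈ 𝒵, V ⊆ K)
    (ν : G → ℝ≥0) (hν : ∀ K : Set G, IsCompact K → BddAbove (ν '' K))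
    (hν1 : (⨅ V : 𝒵, ⨆ r : (V : Set G), ν r) = (1 : ℝ≥0))
    (R : UnifBddClass.{w} α)
    (hR : ∀ X : BanachSp.{w} 𝕜, ∀ ρ ∈ R.mem X,
      RepNonDegenerate ρ.π ∧ RepContractive ρ.π ∧ ∀ r : G, ‖ρ.U r‖ ≤ ν r)
    (𝓧 : Set (BanachSp.{w} 𝕜))
    (hR' : ∀ X ∈ 𝓧, boundedReps α ν X ⊆ R.mem X)
    (hne : ∃ X ∈ 𝓧, (boundedReps α ν X).Nonempty) :
    -- integration is a bijection onto the non-degenerate contractive representations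
    (∀ X ∈ 𝓧, BijOn (fun ρ : R.mem X => integratedRep μ ρ)
      {ρ : R.mem X | ρ.1 ∈ boundedReps α ν X}
      {T : CrossedProduct μ R →ₙₐ[𝕜] (X →L[𝕜] X) | RepNonDegenerate T ∧ RepContractive T}) ∧
    -- it preserves the closed invariant subspaces
    (∀ X ∈ 𝓧, ∀ ρ : R.mem X, ρ.1 ∈ boundedReps α ν X →
      ∀ Z : Submodule 𝕜 X, IsClosed (Z : Set X) →
        (ρ.1.Invariant Z ↔ RepInvariant (integratedRep μ ρ) Z)) ∧
    -- it preserves the bounded intertwining operators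
    (∀ X ∈ 𝓧, ∀ Y ∈ 𝓧, ∀ (ρ : R.mem X) (τ : R.mem Y),
      ρ.1 ∈ boundedReps α ν X → τ.1 ∈ boundedReps α ν Y → ∀ Φ : X →L[𝕜] Y,
        (ρ.1.Intertwines τ.1 Φ ↔ RepIntertwines (integratedRep μ ρ) (integratedRep μ τ) Φ)) ∧
    -- if the system and `R` are involutive, it preserves the property of being involutive
    (∀ [StarRing A] [StarModule 𝕜 A] [ContinuousStar A], α.Involutive →
      (∀ X : BanachSp.{w} 𝕜, ∀ ρ ∈ R.mem X, ρ.Involutive) →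
      ∀ X ∈ 𝓧, ∀ ρ : R.mem X, ρ.1 ∈ boundedReps α ν X →
        (ρ.1.Involutive ↔
          RepInvolutive (CrossedProduct.invol μ R) (integratedRep μ ρ))) := by 
  have hb : R.BoundedBy ν := hR
  have hB := hasBddLeftApproxId_crossedProduct μ hb hA
    (eventually_le_of_iInf_iSup_eq_one h𝒵 h𝒵K hν hν1)
  refine ⟨fun X hX => ⟨?_, ?_, ?_⟩, ?_, ?_, ?_⟩
  · exact fun ρ hρ => ⟨repNonDegenerate_integratedRep μ ρ hρ.1, repContractive_integratedRep μ ρ⟩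
  · intro ρ _ τ _ h
    -- Equal integrated forms are intertwined by the identity operator, hence so are the two pairs.
    refine Subtype.ext (ContCovRep.eq_of_intertwines_id
      (intertwines_of_integratedRep μ hb (ρ := ρ) (τ := τ) fun c => ?_))
    exact DFunLike.congr_fun h.symm c
  · rintro T ⟨hT, hc⟩
    have hmem := disintegrate_mem_boundedReps μ hb hν hB T hT hc (hA 1 one_pos)
    -- Membership in the class is what allows the disintegrated pair to be integrated back to the
    -- completed crossed product.
    refine ⟨⟨_, hR' X hX hmem⟩, hmem, ?_⟩
    ext c : 1
    induction c using CrossedProduct.induction with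
    | hc => exact isClosed_eq (continuous_integratedRep μ _) (repL T hc).continuous
    | h f => rw [integratedRep_q, integrated_disintegrate μ]
  · exact fun X _ ρ _ Z hZ =>
      ⟨RepInvariant.integratedRep μ hZ, invariant_of_integratedRep μ hb (hB 1 one_pos) hZ⟩
  · exact fun X _ Y _ ρ τ _ _ Φ =>
      ⟨RepIntertwines.integratedRep μ, intertwines_of_integratedRep μ hb⟩
  · intro _ _ _ _ hRi X _ ρ _
    -- As `ρ` belongs to an involutive class, both sides of the equivalence hold.
    exact ⟨fun _ => repInvolutive_integratedRep μ hRi ρ, fun _ => hRi X ρ.1 ρ.2⟩
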